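/- Let $p\ge 5$ be a prime with $p\not\equiv 2\pmod 3$, let $\mathbb F$ be a field of characteristic $p$ and let $\lambda=(\lambda_1,\dots,\lambda_p)\in\mathbb F^p$. For $i,j\in\mathbb N$ let $a_{i,j}\in\{-1,0,1\}$ be congruent to $j-i$ modulo $3$. Let $\mathfrak g(p)$ be the Lie algebra over $\mathbb F$ with basis $e_1,\dots,e_p$ and bracket $[e_i,e_j]=a_{i,j}e_{i+j}$ if $i+j\le p$ and $[e_i,e_j]=0$ if $i+j>p$ (the truncation of $\mathfrak n_+(A_1^{(1)})$), and let $\mathfrak g^\lambda(p)$ be the restricted Lie algebra $\mathfrak g(p)$ with $[p]$-operator $\bigl(\sum_i\alpha_ie_i\bigr)^{[p]}=\bigl(\sum_i\alpha_i^p\lambda_i\bigr)e_p$. Let $C^q=(\wedge^q\mathfrak g(p))^*$, let $e^{i,j}\in C^2$ ($1\le i<j\le p$) be dual to $e_i\wedge e_j$, and put $d^1(\psi)(g\wedge h)=\psi([g,h])$ and $d^2(\varphi)(g\wedge h\wedge f)=\varphi([g,h]\wedge f)-\varphi([g,f]\wedge h)+\varphi([h,f]\wedge g)$. Write $[g_1,\dots,g_n]$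 for the left-normed bracket. A map $\omega:\mathfrak g(p)\to\mathbb F$ is $\varphi$-compatible, for $\varphi\in C^2$, if $\omega(\alpha g)=\alpha^p\omega(g)$ and $$\omega(g+h)=\omega(g)+\omega(h)+\sum_{\substack{g_i\in\{g,h\}\\ g_1=g,\ g_2=h}}\frac1{\#(g)}\,\varphi([g_1,\dots,g_{p-1}]\wedge g_p)$$ for all $\alpha\in\mathbb F$ and $g,h\in\mathfrak g(p)$, where the sum is over the words $g_1\cdots g_p$ in the letters $g,h$ with $g_1=g$ and $g_2=h$, and $\#(g)$ is the number of letters $g$. Similarly $\eta:\mathfrak g(p)\times\mathfrak g(p)\to\mathbb F$ is $\zeta$-compatible, for $\zeta\in C^3$, if it is linear in the first variable, $\eta(g,\alpha h)=\alpha^p\eta(g,h)$, and $\eta(g,h_1+h_2)=\eta(g,h_1)+\eta(g,h_2)-\sum\frac1{\#\{i:l_i=1\}}\zeta(g\wedge[h_{l_1},\dots,h_{l_{p-1}}]\wedge h_{l_p})$, the sum being over $l_1,\dots,l_p\in\{1,2\}$ with $l_1=1$, $l_2=2$. Let $C^1_*=C^1$, let $C^2_*$ be the space of pairs $(\varphi,\omega)$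 with $\varphi\in C^2$ and $\omega$ $\varphi$-compatible, and let $C^3_*$ be the space of pairs $(\zeta,\eta)$ with $\zeta\in C^3$ and $\eta$ $\zeta$-compatible. Let $$d^1_*(\psi)=\bigl(d^1\psi,\ g\mapsto\psi(g^{[p]})\bigr),\qquad d^2_*(\varphi,\omega)=\bigl(d^2\varphi,\ (g,h)\mapsto\varphi(g\wedge h^{[p]})\bigr),$$ and $H^2_*(\mathfrak g^\lambda(p))=\ker d^2_*/\operatorname{im}d^1_*$. For $\varphi\in C^2$ let $\widetilde\varphi$ be the unique $\varphi$-compatible map with $\widetilde\varphi(e_k)=0$ for $1\le k\le p$. Let $\overline e^k\bigl(\sum_n\alpha_ne_n\bigr)=\alpha_k^p$, and for $3\le k\le p+1$ let $$\varphi_k=\sum_{1\le i<k/2}a_{i,k-i}\,e^{i,k-i}.$$ Then $$\{(e^{1,4},\widetilde{e^{1,4}}),\ (e^{2,5},\widetilde{e^{2,5}}),\ (\varphi_3,\widetilde{\varphi_3}),\dots,(\varphi_{p+1},\widetilde{\varphi_{p+1}}),\ (0,\overline e^1),\dots,(0,\overline e^p)\}$$ is a basis of $\ker d^2_*$. Moreover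 $\dim H^2_*(\mathfrak g^\lambda(p))=p+3$, and the classes of $$\{(e^{1,4},\widetilde{e^{1,4}}),\ (e^{2,5},\widetilde{e^{2,5}}),\ (\varphi_{p+1},\widetilde{\varphi_{p+1}}),\ (0,\overline e^1),\dots,(0,\overline e^p)\}$$ form a basis of $H^2_*(\mathfrak g^\lambda(p))$. -/

import Mathlib

namespace AffineNil

open Finset

noncomputable section

/-! ### Words, compatible maps and restricted structures on a general Lie algebra -/

section General

variable {F : Type*} [Field F] {L : Type*} [LieRing L] [LieAlgebra F L]

/-- The left-normed bracket `[x 0, x 1, …, x n] = [[⋯[x 0, x 1], …], x n]` of `n + 1` elements. -/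
def leftBracket (x : ℕ → L) : ℕ → L
  | 0 => x 0
  | n + 1 => ⁅leftBracket x n, x (n + 1)⁆

/-- The word in the letters `g`, `h` whose letter number `i` (counted from `0`) is `g` exactly
for `i ∈ S`. -/
def word (S : Finset ℕ) (g h : L) (i : ℕ) : L := if i ∈ S then g else h

/-- The sets `S` of positions that encode the words of length `p` (positions `0, …, p - 1`)
whose first letter is `g` and whose second letter is `h`. The letter `g` occurs `#S` times. -/
def wordSets (p : ℕ) : Finset (Finset ℕ) := {S ∈ (range p).powerset | 0 ∈ S ∧ 1 ∉ S}

variable (F) in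
/-- A restricted structure (a `[p]`-operator) on a Lie algebra over a field of
characteristic `p`. -/
structure IsPOperator (p : ℕ) (P : L → L) : Prop where
  map_smul : ∀ (c : F) (g : L), P (c • g) = c ^ p • P g
  ad_map : ∀ g h : L, ⁅P g, h⁆ = ((LieAlgebra.ad F L g) ^ p) h
  map_add : ∀ g h : L, P (g + h) = P g + P h +
    ∑ S ∈ wordSets p, (#S : F)⁻¹ • leftBracket (word S g h) (p - 1)

/-- `ω : L → F` is `φ`-compatible, for an alternating 2-form `φ`. -/
def IsCompatible (p : ℕ) (φ : L [⋀^Fin 2]→ₗ[F] F) (ω : L → F) : Prop :=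
  (∀ (c : F) (g : L), ω (c • g) = c ^ p * ω g) ∧
  ∀ g h : L, ω (g + h) = ω g + ω h +
    ∑ S ∈ wordSets p, (#S : F)⁻¹ * φ ![leftBracket (word S g h) (p - 2), word S g h (p - 1)]

/-- `η : L × L → F` is `ζ`-compatible, for an alternating 3-form `ζ`. -/
def IsCompatible₂ (p : ℕ) (ζ : L [⋀^Fin 3]→ₗ[F] F) (η : L → L → F) : Prop :=
  (∀ g g' h : L, η (g + g') h = η g h + η g' h) ∧
  (∀ (c : F) (g h : L), η (c • g) h = c * η g h) ∧
  (∀ (c : F) (g h : L), η g (c • h) = c ^ p * η g h) ∧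
  ∀ g h₁ h₂ : L, η g (h₁ + h₂) = η g h₁ + η g h₂ -
    ∑ S ∈ wordSets p, (#S : F)⁻¹ *
      ζ ![g, leftBracket (word S h₁ h₂) (p - 2), word S h₁ h₂ (p - 1)]

theorem alt2_add_left (φ : L [⋀^Fin 2]→ₗ[F] F) (x y z : L) :
    φ ![x + y, z] = φ ![x, z] + φ ![y, z] := by
  exact φ.map_vecCons_add ![z] x y

theorem alt2_smul_left (φ : L [⋀^Fin 2]→ₗ[F] F) (c : F) (x z : L) :
    φ ![c • x, z] = c * φ ![x, z] := by
  exact φ.map_vecCons_smul ![z] c x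

theorem alt2_swap (φ : L [⋀^Fin 2]→ₗ[F] F) (x y : L) : φ ![y, x] = -φ ![x, y] := by
  have h := φ.map_swap ![x, y] (i := 0) (j := 1) (by decide)
  rw [← h]
  congr 1
  ext i
  fin_cases i <;> simp

theorem alt2_self (φ : L [⋀^Fin 2]→ₗ[F] F) (x : L) : φ ![x, x] = 0 :=
  φ.map_eq_zero_of_eq _ (i := 0) (j := 1) (by simp) (by decide)

theorem alt2_add_right (φ : L [⋀^Fin 2]→ₗ[F] F) (x y z : L) :
    φ ![z, x + y] = φ ![z, x] + φ ![z, y] := by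
  rw [alt2_swap, alt2_add_left, alt2_swap φ x z, alt2_swap φ y z]; ring

theorem alt2_smul_right (φ : L [⋀^Fin 2]→ₗ[F] F) (c : F) (x z : L) :
    φ ![z, c • x] = c * φ ![z, x] := by
  rw [alt2_swap, alt2_smul_left, alt2_swap φ x z]; ring

theorem alt2_zero_left (φ : L [⋀^Fin 2]→ₗ[F] F) (z : L) : φ ![0, z] = 0 :=
  φ.map_coord_zero 0 rfl

variable (F L)

/-- The pairs `(φ, ω)` of an alternating 2-form `φ` and a `φ`-compatible map `ω`. -/
def compatiblePairs₂ (p : ℕ) : Submodule F ((L [⋀^Fin 2]→ₗ[F] F) × (L → F)) where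
  carrier := {c | IsCompatible p c.1 c.2}
  zero_mem' := by simp [IsCompatible]
  add_mem' := by
    rintro ⟨φ, ω⟩ ⟨φ', ω'⟩ ⟨h1, h2⟩ ⟨h1', h2'⟩
    refine ⟨fun c g => ?_, fun g h => ?_⟩
    · simp only [Prod.mk_add_mk, Pi.add_apply] at *
      rw [h1, h1', mul_add]
    · simp only [Prod.mk_add_mk, Pi.add_apply, AlternatingMap.add_apply] at *
      rw [h2, h2']
      simp only [mul_add, sum_add_distrib]
      ring
  smul_mem' := by
    rintro a ⟨φ, ω⟩ ⟨h1, h2⟩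
    refine ⟨fun c g => ?_, fun g h => ?_⟩
    · simp only [Prod.smul_mk, Pi.smul_apply, smul_eq_mul] at *
      rw [h1]; ring
    · simp only [Prod.smul_mk, Pi.smul_apply, AlternatingMap.smul_apply, smul_eq_mul] at *
      rw [h2]
      simp only [mul_add, mul_sum]
      congr 1
      exact sum_congr rfl fun S _ => by ring

/-- The space `C²_*` of restricted 2-cochains `(φ, ω)`. -/
def C2Star (p : ℕ) : Type _ := ↥(compatiblePairs₂ F L p)

instance (p : ℕ) : AddCommGroup (C2Star F L p) :=
  inferInstanceAs (AddCommGroup ↥(compatiblePairs₂ F L p))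

instance (p : ℕ) : Module F (C2Star F L p) :=
  inferInstanceAs (Module F ↥(compatiblePairs₂ F L p))

/-- The pairs `(ζ, η)` of an alternating 3-form `ζ` and a `ζ`-compatible map `η`. -/
def compatiblePairs₃ (p : ℕ) : Submodule F ((L [⋀^Fin 3]→ₗ[F] F) × (L → L → F)) where
  carrier := {c | IsCompatible₂ p c.1 c.2}
  zero_mem' := by simp [IsCompatible₂]
  add_mem' := by
    rintro ⟨φ, ω⟩ ⟨φ', ω'⟩ ⟨h1, h2, h3, h4⟩ ⟨h1', h2', h3', h4'⟩
    simp only [Prod.mk_add_mk, Pi.add_apply, AlternatingMap.add_apply, IsCompatible₂,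
      Set.mem_ofPred_eq] at *
    refine ⟨fun g g' h => ?_, fun c g h => ?_, fun c g h => ?_, fun g h h' => ?_⟩
    · rw [h1, h1']; ring
    · rw [h2, h2']; ring
    · rw [h3, h3']; ring
    · rw [h4, h4']
      simp only [mul_add, sum_add_distrib]
      ring
  smul_mem' := by
    rintro a ⟨φ, ω⟩ ⟨h1, h2, h3, h4⟩
    simp only [Prod.smul_mk, Pi.smul_apply, AlternatingMap.smul_apply, smul_eq_mul,
      IsCompatible₂, Set.mem_ofPred_eq] at *
    refine ⟨fun g g' h => ?_, fun c g h => ?_, fun c g h => ?_, fun g h h' => ?_⟩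
    · rw [h1]; ring
    · rw [h2]; ring
    · rw [h3]; ring
    · rw [h4]
      simp only [mul_add, mul_sub, mul_sum]
      congr 1
      exact sum_congr rfl fun S _ => by ring

/-- The space `C³_*` of restricted 3-cochains `(ζ, η)`. -/
def C3Star (p : ℕ) : Type _ := ↥(compatiblePairs₃ F L p)

instance (p : ℕ) : AddCommGroup (C3Star F L p) :=
  inferInstanceAs (AddCommGroup ↥(compatiblePairs₃ F L p))

instance (p : ℕ) : Module F (C3Star F L p) :=
  inferInstanceAs (Module F ↥(compatiblePairs₃ F L p))

/-- `d¹(ψ)(g ∧ h) = ψ([g, h])`. -/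
def d1 : Module.Dual F L →ₗ[F] (L [⋀^Fin 2]→ₗ[F] F) where
  toFun ψ :=
    { toFun := fun v => ψ ⁅v 0, v 1⁆
      map_update_add' := by
        intro _ v i x y
        fin_cases i <;> simp [Function.update]
      map_update_smul' := by
        intro _ v i c x
        fin_cases i <;> simp [Function.update]
      map_eq_zero_of_eq' := by
        intro v i j h hij
        fin_cases i <;> fin_cases j <;> simp_all }
  map_add' ψ ψ' := by ext; simp
  map_smul' c ψ := by ext; simp

/-- `d²(φ)(g ∧ h ∧ f) = φ([g, h] ∧ f) - φ([g, f] ∧ h) + φ([h, f] ∧ g)`. -/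
def d2 : (L [⋀^Fin 2]→ₗ[F] F) →ₗ[F] (L [⋀^Fin 3]→ₗ[F] F) where
  toFun φ :=
    { toFun := fun v => φ ![⁅v 0, v 1⁆, v 2] - φ ![⁅v 0, v 2⁆, v 1] + φ ![⁅v 1, v 2⁆, v 0]
      map_update_add' := by
        intro inst v i x y
        obtain rfl : inst = instDecidableEqFin 3 := Subsingleton.elim _ _
        have hi : i = 0 ∨ i = 1 ∨ i = 2 := by revert i; decide
        rcases hi with rfl | rfl | rfl
        · change φ ![⁅x + y, v 1⁆, v 2] - φ ![⁅x + y, v 2⁆, v 1] + φ ![⁅v 1, v 2⁆, x + y] =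
            (φ ![⁅x, v 1⁆, v 2] - φ ![⁅x, v 2⁆, v 1] + φ ![⁅v 1, v 2⁆, x]) +
            (φ ![⁅y, v 1⁆, v 2] - φ ![⁅y, v 2⁆, v 1] + φ ![⁅v 1, v 2⁆, y])
          simp only [add_lie, alt2_add_left, alt2_add_right]; ring
        · change φ ![⁅v 0, x + y⁆, v 2] - φ ![⁅v 0, v 2⁆, x + y] + φ ![⁅x + y, v 2⁆, v 0] =
            (φ ![⁅v 0, x⁆, v 2] - φ ![⁅v 0, v 2⁆, x] + φ ![⁅x, v 2⁆, v 0]) +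
            (φ ![⁅v 0, y⁆, v 2] - φ ![⁅v 0, v 2⁆, y] + φ ![⁅y, v 2⁆, v 0])
          simp only [add_lie, lie_add, alt2_add_left, alt2_add_right]; ring
        · change φ ![⁅v 0, v 1⁆, x + y] - φ ![⁅v 0, x + y⁆, v 1] + φ ![⁅v 1, x + y⁆, v 0] =
            (φ ![⁅v 0, v 1⁆, x] - φ ![⁅v 0, x⁆, v 1] + φ ![⁅v 1, x⁆, v 0]) +
            (φ ![⁅v 0, v 1⁆, y] - φ ![⁅v 0, y⁆, v 1] + φ ![⁅v 1, y⁆, v 0])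
          simp only [lie_add, alt2_add_left, alt2_add_right]; ring
      map_update_smul' := by
        intro inst v i c x
        obtain rfl : inst = instDecidableEqFin 3 := Subsingleton.elim _ _
        have hi : i = 0 ∨ i = 1 ∨ i = 2 := by revert i; decide
        rcases hi with rfl | rfl | rfl
        · change φ ![⁅c • x, v 1⁆, v 2] - φ ![⁅c • x, v 2⁆, v 1] + φ ![⁅v 1, v 2⁆, c • x] =
            c * (φ ![⁅x, v 1⁆, v 2] - φ ![⁅x, v 2⁆, v 1] + φ ![⁅v 1, v 2⁆, x])
          simp only [smul_lie, alt2_smul_left, alt2_smul_right]; ring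
        · change φ ![⁅v 0, c • x⁆, v 2] - φ ![⁅v 0, v 2⁆, c • x] + φ ![⁅c • x, v 2⁆, v 0] =
            c * (φ ![⁅v 0, x⁆, v 2] - φ ![⁅v 0, v 2⁆, x] + φ ![⁅x, v 2⁆, v 0])
          simp only [smul_lie, lie_smul, alt2_smul_left, alt2_smul_right]; ring
        · change φ ![⁅v 0, v 1⁆, c • x] - φ ![⁅v 0, c • x⁆, v 1] + φ ![⁅v 1, c • x⁆, v 0] =
            c * (φ ![⁅v 0, v 1⁆, x] - φ ![⁅v 0, x⁆, v 1] + φ ![⁅v 1, x⁆, v 0])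
          simp only [lie_smul, alt2_smul_left, alt2_smul_right]; ring
      map_eq_zero_of_eq' := by
        intro v i j h hij
        have neg : ∀ a b c : L, φ ![⁅a, b⁆, c] = -φ ![⁅b, a⁆, c] := by
          intro a b c
          rw [← lie_skew, ← neg_one_smul F, alt2_smul_left]
          ring
        have h01 : v 0 = v 1 →
            φ ![⁅v 0, v 1⁆, v 2] - φ ![⁅v 0, v 2⁆, v 1] + φ ![⁅v 1, v 2⁆, v 0] = 0 := by
          intro h
          rw [h, lie_self, alt2_zero_left]; ring
        have h02 : v 0 = v 2 →
            φ ![⁅v 0, v 1⁆, v 2] - φ ![⁅v 0, v 2⁆, v 1] + φ ![⁅v 1, v 2⁆, v 0] = 0 := by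
          intro h
          rw [h, lie_self, alt2_zero_left, neg (v 1)]; ring
        have h12 : v 1 = v 2 →
            φ ![⁅v 0, v 1⁆, v 2] - φ ![⁅v 0, v 2⁆, v 1] + φ ![⁅v 1, v 2⁆, v 0] = 0 := by
          intro h
          rw [h, lie_self, alt2_zero_left]; ring
        fin_cases i <;> fin_cases j <;>
          first
          | exact absurd rfl hij
          | exact h01 h
          | exact h02 h
          | exact h12 h
          | exact h01 h.symm
          | exact h02 h.symm
          | exact h12 h.symm }
  map_add' φ φ' := by ext; simp; ring
  map_smul' c φ := by ext; simp; ring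

end General

/-! ### The Lie algebra `𝔤(p)` -/

/-- The coefficient `a_{i,j} ∈ {-1, 0, 1}`, congruent to `j - i` modulo `3`. -/
def a (i j : ℕ) : ℤ :=
  if ((j : ℤ) - i) % 3 = 0 then 0 else if ((j : ℤ) - i) % 3 = 1 then 1 else -1

/-- The truncation `𝔤(p)` of `n₊(A₁⁽¹⁾)`: its elements are the coordinate families
`(α_k)_{1 ≤ k ≤ p}` with respect to the basis `e_1, …, e_p`. -/
def G (F : Type*) (p : ℕ) : Type _ := ↥(Icc 1 p) → F

variable {F : Type*} [Field F] {p : ℕ}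

instance : AddCommGroup (G F p) := inferInstanceAs (AddCommGroup (↥(Icc 1 p) → F))

instance : Module F (G F p) := inferInstanceAs (Module F (↥(Icc 1 p) → F))

/-- The coordinate functional `e^k` (zero unless `1 ≤ k ≤ p`). -/
def coord (k : ℕ) : Module.Dual F (G F p) where
  toFun g := if h : k ∈ Icc 1 p then g ⟨k, h⟩ else 0
  map_add' g h := by
    split_ifs
    · rfl
    · simp
  map_smul' c g := by
    split_ifs
    · rfl
    · simp

/-- The basis vector `e_k` (zero unless `1 ≤ k ≤ p`). -/
def e (k : ℕ) : G F p := fun i => if i.1 = k then 1 else 0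

theorem coord_e (k l : ℕ) (hl : l ∈ Icc 1 p) :
    coord l (e k : G F p) = if l = k then 1 else 0 := by
  simp only [coord, e, LinearMap.coe_mk, AddHom.coe_mk, dif_pos hl]

theorem coord_of_notMem (k : ℕ) (hk : k ∉ Icc 1 p) (g : G F p) : coord k g = 0 := by
  simp only [coord, LinearMap.coe_mk, AddHom.coe_mk, dif_neg hk]

theorem coord_zero_index (g : G F p) : coord 0 g = 0 := coord_of_notMem 0 (by simp) g

theorem ext_coord {g h : G F p} (H : ∀ k ∈ Icc 1 p, coord k g = coord k h) : g = h := by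
  funext ⟨k, hk⟩
  have := H k hk
  simpa only [coord, LinearMap.coe_mk, AddHom.coe_mk, dif_pos hk] using this

/-- Coefficient of `e_n` in the bracket of `∑ x i e_i` and `∑ y j e_j`,
where `[e_i, e_j] = a_{i,j} e_{i+j}`. -/
def bracketCoeff (x y : ℕ → F) (n : ℕ) : F :=
  ∑ q ∈ antidiagonal n, (a q.1 q.2 : F) * x q.1 * y q.2

/-- `[e_i, e_j] = a_{i,j} e_{i+j}`, where `e_k = 0` for `k > p`. -/
instance : Bracket (G F p) (G F p) where
  bracket g h := fun k => bracketCoeff (fun i => coord i g) (fun j => coord j h) k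

theorem coord_bracket (g h : G F p) {k : ℕ} (hk : k ≤ p) :
    coord k ⁅g, h⁆ = bracketCoeff (fun i => coord i g) (fun j => coord j h) k := by
  rcases Nat.eq_zero_or_pos k with rfl | h0
  · simp [bracketCoeff, coord_zero_index]
  · have : k ∈ Icc 1 p := by simp; omega
    simp only [coord, Bracket.bracket, LinearMap.coe_mk, AddHom.coe_mk, dif_pos this]

theorem a_skew (i j : ℕ) : a j i = -a i j := by
  unfold a; split_ifs <;> omega

theorem a_self (i : ℕ) : a i i = 0 := by simp [a]

theorem a_congr {i j i' j' : ℕ} (h : ((j : ℤ) - i) % 3 = ((j' : ℤ) - i') % 3) :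
    a i j = a i' j' := by
  simp only [a, h]

theorem a_jacobi (i j k : ℕ) :
    a i (j + k) * a j k = a i j * a (i + j) k + a i k * a j (i + k) := by
  have key : ∀ i j k : Fin 3, a i (j + k : ℕ) * a j k =
      a i j * a (i + j : ℕ) k + a i k * a j (i + k : ℕ) := by decide
  have h := key ⟨i % 3, Nat.mod_lt _ (by norm_num)⟩ ⟨j % 3, Nat.mod_lt _ (by norm_num)⟩
    ⟨k % 3, Nat.mod_lt _ (by norm_num)⟩
  have e1 : a (i % 3) (j % 3 + k % 3) = a i (j + k) := a_congr (by omega)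
  have e2 : a (i % 3 + j % 3) (k % 3) = a (i + j) k := a_congr (by omega)
  have e3 : a (j % 3) (i % 3 + k % 3) = a j (i + k) := a_congr (by omega)
  have e4 : a (i % 3) (j % 3) = a i j := a_congr (by omega)
  have e5 : a (i % 3) (k % 3) = a i k := a_congr (by omega)
  have e6 : a (j % 3) (k % 3) = a j k := a_congr (by omega)
  simpa only [e1, e2, e3, e4, e5, e6] using h

theorem bracketCoeff_self (x : ℕ → F) (n : ℕ) : bracketCoeff x x n = 0 := by
  unfold bracketCoeff
  refine sum_involution (fun q _ => q.swap) ?_ ?_ ?_ ?_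
  · rintro ⟨i, j⟩ _
    simp only [Prod.swap]
    rw [a_skew i j]
    push_cast; ring
  · rintro ⟨i, j⟩ _ h1 h2
    simp only [Prod.swap, Prod.mk.injEq] at h2
    obtain ⟨rfl, -⟩ := h2
    simp [a_self] at h1
  · rintro ⟨i, j⟩ h
    simpa [add_comm] using h
  · rintro ⟨i, j⟩ _
    rfl

theorem bracketCoeff_congr {x x' y y' : ℕ → F} {n : ℕ} (hx : ∀ i ≤ n, x i = x' i)
    (hy : ∀ i ≤ n, y i = y' i) : bracketCoeff x y n = bracketCoeff x' y' n := by
  refine sum_congr rfl fun q hq => ?_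
  rw [HasAntidiagonal.mem_antidiagonal] at hq
  rw [hx _ (by omega), hy _ (by omega)]

theorem bracketCoeff_jacobi (x y z : ℕ → F) (n : ℕ) :
    bracketCoeff x (bracketCoeff y z) n =
      bracketCoeff (bracketCoeff x y) z n + bracketCoeff y (bracketCoeff x z) n := by
  have h1 : bracketCoeff (bracketCoeff x y) z n =
      ∑ q ∈ antidiagonal n, ∑ r ∈ antidiagonal q.2,
        (a q.1 r.1 * a (q.1 + r.1) r.2 : F) * x q.1 * y r.1 * z r.2 := by
    simp only [bracketCoeff, mul_sum, sum_mul, sum_sigma']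
    refine sum_nbij' (fun ⟨⟨_, l⟩, ⟨i, j⟩⟩ => ⟨(i, j + l), (j, l)⟩)
      (fun ⟨⟨i, _⟩, ⟨j, l⟩⟩ => ⟨(i + j, l), (i, j)⟩) ?_ ?_ ?_ ?_ ?_ <;>
    · rintro ⟨⟨i, j⟩, ⟨k, l⟩⟩ h
      simp only [mem_sigma, HasAntidiagonal.mem_antidiagonal] at h
      obtain ⟨rfl, rfl⟩ := h
      first
      | (simp [add_assoc]; done)
      | (dsimp only; ring)
  have h2 : bracketCoeff y (bracketCoeff x z) n =
      ∑ q ∈ antidiagonal n, ∑ r ∈ antidiagonal q.2,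
        (a q.1 r.2 * a r.1 (q.1 + r.2) : F) * x q.1 * y r.1 * z r.2 := by
    simp only [bracketCoeff, mul_sum, sum_sigma']
    refine sum_nbij' (fun ⟨⟨i, _⟩, ⟨j, l⟩⟩ => ⟨(j, i + l), (i, l)⟩)
      (fun ⟨⟨i, _⟩, ⟨j, l⟩⟩ => ⟨(j, i + l), (i, l)⟩) ?_ ?_ ?_ ?_ ?_ <;>
    · rintro ⟨⟨i, j⟩, ⟨k, l⟩⟩ h
      simp only [mem_sigma, HasAntidiagonal.mem_antidiagonal] at h
      obtain ⟨rfl, rfl⟩ := h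
      first
      | (simp [add_left_comm]; done)
      | (dsimp only; ring)
  rw [h1, h2, ← sum_add_distrib]
  simp only [bracketCoeff, mul_sum]
  refine sum_congr rfl fun q hq => ?_
  rw [← sum_add_distrib]
  refine sum_congr rfl fun r hr => ?_
  rw [HasAntidiagonal.mem_antidiagonal] at hq hr
  have := congrArg (Int.cast : ℤ → F) (a_jacobi q.1 r.1 r.2)
  push_cast at this
  rw [hr] at this
  linear_combination (x q.1 * y r.1 * z r.2) * this

instance : LieRing (G F p) where
  add_lie x y z := by
    refine ext_coord fun k hk => ?_
    have hk' := (mem_Icc.1 hk).2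
    simp only [map_add, coord_bracket _ _ hk', bracketCoeff, mul_add, add_mul, sum_add_distrib]
  lie_add x y z := by
    refine ext_coord fun k hk => ?_
    have hk' := (mem_Icc.1 hk).2
    simp only [map_add, coord_bracket _ _ hk', bracketCoeff, mul_add, sum_add_distrib]
  lie_self x := by
    refine ext_coord fun k hk => ?_
    rw [coord_bracket _ _ (mem_Icc.1 hk).2, bracketCoeff_self, map_zero]
  leibniz_lie x y z := by
    refine ext_coord fun k hk => ?_
    have hk' := (mem_Icc.1 hk).2
    simp only [map_add, coord_bracket _ _ hk']
    rw [bracketCoeff_congr (fun i _ => rfl) (fun i hi => coord_bracket y z (hi.trans hk')),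
      bracketCoeff_congr (fun i hi => coord_bracket x y (hi.trans hk')) (fun i _ => rfl),
      bracketCoeff_congr (fun i _ => rfl) (fun i hi => coord_bracket x z (hi.trans hk'))]
    exact bracketCoeff_jacobi _ _ _ k

instance : LieAlgebra F (G F p) where
  lie_smul c x y := by
    refine ext_coord fun k hk => ?_
    have hk' := (mem_Icc.1 hk).2
    simp only [map_smul, coord_bracket _ _ hk', bracketCoeff, smul_eq_mul, mul_sum]
    exact sum_congr rfl fun q _ => by ring

/-- The defining relations of `𝔤(p)`. -/
theorem e_bracket (i j : ℕ) (hi : i ∈ Icc 1 p) (hj : j ∈ Icc 1 p) :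
    ⁅(e i : G F p), (e j : G F p)⁆ = (a i j : F) • e (i + j) := by
  refine ext_coord fun k hk => ?_
  rw [coord_bracket _ _ (mem_Icc.1 hk).2, map_smul, coord_e _ _ hk, smul_eq_mul]
  have hc : ∀ m ∈ Icc 1 p, ∀ l : ℕ, coord l (e m : G F p) = if l = m then 1 else 0 := by
    intro m hm l
    by_cases hl : l ∈ Icc 1 p
    · exact coord_e m l hl
    · rw [coord_of_notMem l hl, if_neg]
      rintro rfl
      exact hl hm
  unfold bracketCoeff
  simp only [hc i hi, hc j hj]
  by_cases h : k = i + j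
  · rw [sum_eq_single (i, j)]
    · simp [h]
    · rintro ⟨u, v⟩ _ hne
      by_cases hu : u = i
      · have : v ≠ j := fun hv => hne (by rw [hu, hv])
        simp [this]
      · simp [hu]
    · intro hn
      exact absurd (HasAntidiagonal.mem_antidiagonal.2 h.symm) hn
  · rw [if_neg h, mul_zero]
    refine sum_eq_zero fun q hq => ?_
    rw [HasAntidiagonal.mem_antidiagonal] at hq
    by_cases hu : q.1 = i
    · have : q.2 ≠ j := by omega
      simp [this]
    · simp [hu]

/-! ### Vanishing of long brackets -/

theorem coord_bracket_eq_zero {m : ℕ} {g : G F p} (hg : ∀ k ≤ m, coord k g = 0) (h : G F p)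
    {k : ℕ} (hk : k ≤ m + 1) : coord k ⁅g, h⁆ = 0 := by
  by_cases hkp : k ≤ p
  · rw [coord_bracket _ _ hkp]
    refine sum_eq_zero fun q hq => ?_
    beta_reduce
    rw [HasAntidiagonal.mem_antidiagonal] at hq
    rcases Nat.eq_zero_or_pos q.2 with h0 | h0
    · rw [h0, coord_zero_index, mul_zero]
    · rw [hg q.1 (by omega), mul_zero, zero_mul]
  · exact coord_of_notMem _ (by simp; omega) _

theorem coord_bracket_eq_zero_five {g : G F p} (hg : ∀ k ≤ 3, coord k g = 0) (h : G F p)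
    {k : ℕ} (hk : k ≤ 5) : coord k ⁅g, h⁆ = 0 := by
  by_cases hkp : k ≤ p
  · rw [coord_bracket _ _ hkp]
    refine sum_eq_zero fun q hq => ?_
    beta_reduce
    rw [HasAntidiagonal.mem_antidiagonal] at hq
    rcases Nat.eq_zero_or_pos q.2 with h0 | h0
    · rw [h0, coord_zero_index, mul_zero]
    · by_cases h4 : q.1 ≤ 3
      · rw [hg q.1 h4, mul_zero, zero_mul]
      · have e1 : q.1 = 4 := by omega
        have e2 : q.2 = 1 := by omega
        simp [e1, e2, a]
  · exact coord_of_notMem _ (by simp; omega) _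

theorem coord_bracket_two (g h : G F p) {k : ℕ} (hk : k ≤ 2) : coord k ⁅g, h⁆ = 0 := by
  by_cases hkp : k ≤ p
  · rw [coord_bracket _ _ hkp]
    refine sum_eq_zero fun q hq => ?_
    beta_reduce
    rw [HasAntidiagonal.mem_antidiagonal] at hq
    rcases Nat.eq_zero_or_pos q.2 with h0 | h0
    · rw [h0, coord_zero_index, mul_zero]
    · rcases Nat.eq_zero_or_pos q.1 with h1 | h1
      · rw [h1, coord_zero_index, mul_zero, zero_mul]
      · have e1 : q.1 = 1 := by omega
        have e2 : q.2 = 1 := by omega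
        simp [e1, e2, a]
  · exact coord_of_notMem _ (by simp; omega) _

theorem coord_leftBracket (x : ℕ → G F p) (n k : ℕ) (hk : k ≤ n + 5) :
    coord k (leftBracket x (n + 3)) = 0 := by
  induction n generalizing k with
  | zero =>
    exact coord_bracket_eq_zero_five
      (fun k hk => coord_bracket_eq_zero (m := 2) (fun k hk => coord_bracket_two _ _ hk) _ hk) _ hk
  | succ n ih => exact coord_bracket_eq_zero (m := n + 5) (fun k hk => ih k hk) _ (by omega)

theorem leftBracket_eq_zero (x : ℕ → G F p) {n : ℕ} (h3 : 3 ≤ n) (hn : p ≤ n + 2) :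
    leftBracket x n = 0 := by
  obtain ⟨m, rfl⟩ := Nat.exists_eq_add_of_le' h3
  refine ext_coord fun k hk => ?_
  rw [coord_leftBracket x m k (by have := (mem_Icc.1 hk).2; omega), map_zero]

/-! ### The restricted Lie algebras `𝔤^λ(p)` -/

/-- The `[p]`-operator of `𝔤^λ(p)`: `(∑ α_i e_i)^[p] = (∑ α_i ^ p λ_i) e_p`. -/
def pOp (lam : ↥(Icc 1 p) → F) (g : G F p) : G F p :=
  (∑ i : ↥(Icc 1 p), coord i g ^ p * lam i) • e p

theorem pOp_lie (lam : ↥(Icc 1 p) → F) (g h : G F p) : ⁅pOp lam g, h⁆ = 0 := by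
  refine ext_coord fun k hk => ?_
  have h1 := (mem_Icc.1 hk).1
  have h2 := (mem_Icc.1 hk).2
  rw [map_zero, pOp, smul_lie, map_smul]
  rw [coord_bracket_eq_zero (m := p - 1) _ h (by omega), smul_zero]
  intro k hk
  by_cases hk1 : k ∈ Icc 1 p
  · rw [coord_e _ _ hk1, if_neg (by omega)]
  · exact coord_of_notMem _ hk1 _

theorem pOp_smul (lam : ↥(Icc 1 p) → F) (c : F) (g : G F p) :
    pOp lam (c • g) = c ^ p • pOp lam g := by
  simp only [pOp, map_smul, smul_eq_mul, mul_pow, smul_smul, mul_sum, mul_assoc]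

theorem pOp_add [Fact p.Prime] [CharP F p] (lam : ↥(Icc 1 p) → F) (g h : G F p) :
    pOp lam (g + h) = pOp lam g + pOp lam h := by
  simp only [pOp, map_add, add_pow_char, add_mul, sum_add_distrib, add_smul]

theorem isPOperator_pOp [Fact p.Prime] [CharP F p] (hp : 5 ≤ p) (lam : ↥(Icc 1 p) → F) :
    IsPOperator F p (pOp lam) where
  map_smul := pOp_smul lam
  ad_map g h := by
    rw [pOp_lie]
    have key : ∀ n k : ℕ, k ≤ n → coord k (((LieAlgebra.ad F (G F p) g) ^ n) h) = 0 := by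
      intro n
      induction n with
      | zero =>
        intro k hk
        obtain rfl : k = 0 := by omega
        exact coord_zero_index _
      | succ n ih =>
        intro k hk
        rw [pow_succ', Module.End.mul_apply, LieAlgebra.ad_apply, ← lie_skew, map_neg,
          coord_bracket_eq_zero ih g hk, neg_zero]
    refine ext_coord fun k hk => ?_
    rw [key p k (mem_Icc.1 hk).2, map_zero]
  map_add g h := by
    rw [pOp_add, sum_eq_zero, add_zero]
    intro S _
    rw [leftBracket_eq_zero _ (by omega) (by omega), smul_zero]

/-! ### Restricted cochains of `𝔤^λ(p)` -/

theorem isCompatible_iff (hp : 5 ≤ p) (φ : G F p [⋀^Fin 2]→ₗ[F] F) (ω : G F p → F) :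
    IsCompatible p φ ω ↔
      (∀ (c : F) (g : G F p), ω (c • g) = c ^ p * ω g) ∧ ∀ g h, ω (g + h) = ω g + ω h := by
  have : ∀ g h : G F p, ∑ S ∈ wordSets p, (#S : F)⁻¹ *
      φ ![leftBracket (word S g h) (p - 2), word S g h (p - 1)] = 0 := by
    intro g h
    refine sum_eq_zero fun S _ => ?_
    rw [leftBracket_eq_zero _ (by omega) (by omega), alt2_zero_left, mul_zero]
  simp only [IsCompatible, this, add_zero]

/-- For every 2-form `φ` there is exactly one `φ`-compatible map that vanishes on
`e_1, …, e_p`. -/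
theorem existsUnique_tilde (hp : 5 ≤ p) (φ : G F p [⋀^Fin 2]→ₗ[F] F) :
    ∃! ω : G F p → F, IsCompatible p φ ω ∧ ∀ k ∈ Icc 1 p, ω (e k) = 0 := by
  refine ⟨0, ⟨(isCompatible_iff hp φ 0).2 (by simp), by simp⟩, ?_⟩
  rintro ω ⟨h, he⟩
  obtain ⟨h1, h2⟩ := (isCompatible_iff hp φ ω).1 h
  have h0 : ω 0 = 0 := by simpa using h2 0 0
  funext g
  have hg : g = ∑ i : ↥(Icc 1 p), g i • (e i : G F p) := by
    funext j
    have : ∀ (s : Finset ↥(Icc 1 p)), (∑ i ∈ s, g i • (e i : G F p)) j =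
        ∑ i ∈ s, g i * (if j.1 = i.1 then 1 else 0) := by
      intro s
      induction s using Finset.induction_on with
      | empty => rfl
      | insert a s ha ih => rw [sum_insert ha, sum_insert ha, ← ih]; rfl
    rw [this]
    have h2 : ∀ i : ↥(Icc 1 p), (j.1 = i.1) = (j = i) := fun i => propext Subtype.ext_iff.symm
    simp only [h2, mul_ite, mul_one, mul_zero]
    exact (by rw [sum_ite_eq]; simp :
      (∑ i : ↥(Icc 1 p), if j = i then (show ↥(Icc 1 p) → F from g) i else 0) = g j).symm
  have hs : ∀ (s : Finset ↥(Icc 1 p)), ω (∑ i ∈ s, g i • (e i : G F p)) = 0 := by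
    intro s
    induction s using Finset.induction_on with
    | empty => simpa using h0
    | insert a s ha ih => rw [sum_insert ha, h2, ih, h1, he _ a.2]; simp
  rw [hg, hs]; rfl

/-- The unique `φ`-compatible map that vanishes on `e_1, …, e_p`. -/
def tilde (hp : 5 ≤ p) (φ : G F p [⋀^Fin 2]→ₗ[F] F) : G F p → F :=
  (existsUnique_tilde hp φ).choose

theorem tilde_spec (hp : 5 ≤ p) (φ : G F p [⋀^Fin 2]→ₗ[F] F) :
    IsCompatible p φ (tilde hp φ) ∧ ∀ k ∈ Icc 1 p, tilde hp φ (e k) = 0 :=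
  (existsUnique_tilde hp φ).choose_spec.1

/-- `d¹_*(ψ) = (d¹(ψ), ind¹(ψ))` with `ind¹(ψ)(g) = ψ(g^[p])`. -/
def d1Star [Fact p.Prime] [CharP F p] (hp : 5 ≤ p) (lam : ↥(Icc 1 p) → F) :
    Module.Dual F (G F p) →ₗ[F] C2Star F (G F p) p where
  toFun ψ := ⟨(d1 F (G F p) ψ, fun g => ψ (pOp lam g)), (isCompatible_iff hp _ _).2
    ⟨fun c g => by dsimp only; rw [pOp_smul, map_smul, smul_eq_mul],
      fun g h => by dsimp only; rw [pOp_add, map_add]⟩⟩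
  map_add' ψ ψ' := by
    refine Subtype.ext (Prod.ext (map_add (d1 F (G F p)) ψ ψ') rfl)
  map_smul' c ψ := by
    exact Subtype.ext (Prod.ext (map_smul (d1 F (G F p)) c ψ) rfl)

/-- `d²_*(φ, ω) = (d²(φ), ind²(φ, ω))` with `ind²(φ, ω)(g, h) = φ(g ∧ h^[p])`. -/
def d2Star [Fact p.Prime] [CharP F p] (hp : 5 ≤ p) (lam : ↥(Icc 1 p) → F) :
    C2Star F (G F p) p →ₗ[F] C3Star F (G F p) p where
  toFun c := ⟨(d2 F (G F p) c.1.1, fun g h => c.1.1 ![g, pOp lam h]), by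
    refine ⟨fun g g' h => alt2_add_left _ _ _ _, fun r g h => alt2_smul_left _ _ _ _,
      fun r g h => ?_, fun g h h' => ?_⟩
    · simp only [pOp_smul, alt2_smul_right]
    · simp only [pOp_add, alt2_add_right]
      rw [sum_eq_zero, sub_zero]
      intro S _
      rw [leftBracket_eq_zero _ (by omega) (by omega), AlternatingMap.map_coord_zero _ 1 rfl,
        mul_zero]⟩
  map_add' c c' := by
    exact Subtype.ext (Prod.ext (map_add (d2 F (G F p)) c.1.1 c'.1.1) rfl)
  map_smul' r c := by
    exact Subtype.ext (Prod.ext (map_smul (d2 F (G F p)) r c.1.1) rfl)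

theorem d2Star_d1Star [Fact p.Prime] [CharP F p] (hp : 5 ≤ p) (lam : ↥(Icc 1 p) → F)
    (ψ : Module.Dual F (G F p)) : d2Star hp lam (d1Star hp lam ψ) = 0 := by
  apply Subtype.ext
  refine Prod.ext ?_ ?_
  · ext v
    have := leibniz_lie (v 0) (v 1) (v 2)
    change ψ ⁅⁅v 0, v 1⁆, v 2⁆ - ψ ⁅⁅v 0, v 2⁆, v 1⁆ + ψ ⁅⁅v 1, v 2⁆, v 0⁆ = 0
    rw [← map_sub, ← map_add, ← lie_skew ⁅v 1, v 2⁆ (v 0), this, ← lie_skew ⁅v 0, v 2⁆ (v 1)]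
    convert map_zero ψ
    abel
  · funext g h
    change ψ ⁅g, pOp lam h⁆ = 0
    rw [← lie_skew, pOp_lie, neg_zero, map_zero]

/-- `H²_*(𝔤^λ(p)) = ker d²_* / im d¹_*`. -/
abbrev H2Star [Fact p.Prime] [CharP F p] (hp : 5 ≤ p) (lam : ↥(Icc 1 p) → F) : Type _ :=
  LinearMap.ker (d2Star hp lam) ⧸
    (LinearMap.range (d1Star hp lam)).submoduleOf (LinearMap.ker (d2Star hp lam))

/-! ### The explicit cochains -/

/-- `e^{i,j}`, the element of the basis of `C²` dual to `e_i ∧ e_j`. -/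
def eDual (i j : ℕ) : G F p [⋀^Fin 2]→ₗ[F] F where
  toFun v := coord i (v 0) * coord j (v 1) - coord j (v 0) * coord i (v 1)
  map_update_add' := by
    intro _ v k x y
    fin_cases k <;> simp [Function.update] <;> ring
  map_update_smul' := by
    intro _ v k c x
    fin_cases k <;> simp [Function.update] <;> ring
  map_eq_zero_of_eq' := by
    intro v k l h hkl
    fin_cases k <;> fin_cases l <;> simp_all <;> ring

/-- The first index of the sum that defines `φ_k`. -/
def idxM (p k : ℕ) : ℕ := if k ≤ p + 1 then 1 else k - p

/-- The last index of the sum that defines `φ_k`. -/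
def idxS (k : ℕ) : ℕ := if Even k then k / 2 - 1 else (k - 1) / 2

/-- `φ_k = ∑_{i = M(p,k)}^{s(k)} a_{i,k-i} e^{i,k-i}`. -/
def phi (k : ℕ) : G F p [⋀^Fin 2]→ₗ[F] F :=
  ∑ i ∈ Icc (idxM p k) (idxS k), (a i (k - i) : F) • eDual i (k - i)

/-- The restricted cochain `(φ, φ̃)`. -/
def tildePair (hp : 5 ≤ p) (φ : G F p [⋀^Fin 2]→ₗ[F] F) : C2Star F (G F p) p :=
  ⟨(φ, tilde hp φ), (tilde_spec hp φ).1⟩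

/-- The restricted cochain `(0, ē^k)` with `ē^k (∑ α_n e_n) = α_k ^ p`. -/
def eBarPair [Fact p.Prime] [CharP F p] (hp : 5 ≤ p) (k : ℕ) : C2Star F (G F p) p :=
  ⟨(0, fun g => coord k g ^ p), (isCompatible_iff hp _ _).2
    ⟨fun c g => by dsimp only; rw [map_smul, smul_eq_mul, mul_pow],
      fun g h => by dsimp only; rw [map_add, add_pow_char]⟩⟩

end

end AffineNil

namespace AffineNil

open Finset

noncomputable section

/-! Left-normed brackets of `p - 1` elements vanish, so compatible maps are just the `p`-semilinear
maps, determined by their values on the `e_k`. A restricted 2-cocycle is then a 2-form `φ` with `d2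
φ = 0` and a vanishing condition on `φ(g ∧ h^[p])`, together with an arbitrary `p`-semilinear map;
the latter accounts for the `(0, ē^k)`.

The forms are found weight by weight, the weight of `φ(e_i ∧ e_j)` being `k = i + j`. Setting `e_k =
0` for `k > p` makes the values of `φ` a cocycle on all of `n₊(A₁⁽¹⁾)`. In a fixed weight, the
Jacobi relations with `e_1` and `e_2` are recursions along the antidiagonal, and together with
skew-symmetry they force the cocycle to vanish as soon as one leading value does. Only weights 5 and
7 need a second value, because there the recursion merely repeats skew-symmetry; this produces
`e^{1,4}` and `e^{2,5}`. The three residues of `k` modulo 3 are `eq_zero_of_mod_zero`,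
`eq_zero_of_mod_one` and `eq_zero_of_mod_two`. For weights above `p + 1` the leading value vanishes
by truncation. Since `p ≡ 1` modulo 3, `a_{1,p} = 0`, so the listed forms all kill `e_p` and the
condition on `h^[p]` costs nothing, whatever `λ` is.

Both bases come from biorthogonal functionals that separate points, the separation being
`eq_zero_of_mem_ker`. For `k < p` the cocycle `φ_k` is the coboundary of `e^k`, while `e^p` has
coboundary `φ_p` plus `∑ λ_k ē^k`. The form `φ_{p+1}` is the would-be coboundary of the missing
`e^{p+1}` and survives. Correcting the functionals by the `φ_p`-coefficient makes them descend to
`H²_*`. -/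

theorem a_eq_zero {i j : ℕ} (h : ((j : ℤ) - i) % 3 = 0) : a i j = 0 := by
  simp [a, h]

theorem a_eq_one {i j : ℕ} (h : ((j : ℤ) - i) % 3 = 1) : a i j = 1 := by
  simp [a, h]

theorem a_eq_neg_one {i j : ℕ} (h : ((j : ℤ) - i) % 3 = 2) : a i j = -1 := by
  simp [a, h]

/-- The cocycle identity for the values of a 2-form on the basis vectors `e_1, e_2, …` of
`n₊(A₁⁽¹⁾)`. -/
structure IsCocycle {F : Type*} [Field F] (X : ℕ → ℕ → F) : Prop where
  skew : ∀ i j, X j i = -X i j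
  jacobi : ∀ i j l, 1 ≤ i → 1 ≤ j → 1 ≤ l →
    (a i j : F) * X (i + j) l - a i l * X (i + l) j + a j l * X (j + l) i = 0

/-! ### Cocycles on `n₊(A₁⁽¹⁾)` in a fixed weight -/

namespace IsCocycle

variable {F : Type*} [Field F] {X : ℕ → ℕ → F} (hX : IsCocycle X)

include hX

/-- The Jacobi relation of `e_s`, `e_j`, `e_{k-s-j}` involves only weight `k`. Written in `X_i = X i
(k - i)` it links `X_{j+s}`, `X_j` and `X_s`; taking `s = 1, 2` gives all the recursions below. -/
theorem jacobi_diag {s j k : ℕ} (hs : 1 ≤ s) (hj : 1 ≤ j) (hk : s + j < k) :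
    (a s j : F) * X (j + s) (k - (j + s)) + a s (k - s - j) * X j (k - j) =
      a j (k - s - j) * X s (k - s) := by
  have h := hX.jacobi s j (k - s - j) hs hj (by omega)
  rw [hX.skew j (s + _), hX.skew s (j + _), show k - s - j = k - (j + s) by omega,
    show s + (k - (j + s)) = k - j by omega, show j + (k - (j + s)) = k - s by omega,
    add_comm s j] at h
  rw [show k - s - j = k - (j + s) by omega]
  linear_combination h

theorem skew_diag {i k : ℕ} (hi : i ≤ k) : X (k - i) (k - (k - i)) = -X i (k - i) := by
  rw [Nat.sub_sub_self hi, hX.skew i (k - i)]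

/-- Once `X_1 = 0`, the recursions give the value `(m + 1) X_2` at `3m + 2`, `3m + 3` and `3m + 4`.
Comparing `X_{k-2}` with `-X_2` leaves `(k / 3) X_2 = 0`. -/
theorem eq_zero_of_mod_zero {k : ℕ} (hk : k % 3 = 0) (hkF : ((k / 3 : ℕ) : F) ≠ 0)
    (h1 : X 1 (k - 1) = 0) {i : ℕ} (hi : 1 ≤ i) (hik : i < k) : X i (k - i) = 0 := by
  have A : ∀ j, 1 ≤ j → j + 1 < k → j % 3 ≠ 1 → X (j + 1) (k - (j + 1)) = X j (k - j) := by
    intro j hj hjk hj3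
    have h := hX.jacobi_diag (s := 1) le_rfl hj (k := k) (by omega)
    rw [h1] at h
    obtain h3 | h3 : j % 3 = 0 ∨ j % 3 = 2 := by omega
    · rw [a_eq_neg_one (j := j) (by omega), a_eq_one (by omega)] at h
      push_cast at h
      linear_combination -h
    · rw [a_eq_one (j := j) (by omega), a_eq_neg_one (by omega)] at h
      push_cast at h
      linear_combination h
  -- The relation with `e_1` is empty for `j ≡ 1`, so the step into residue 2 is made from residue 0
  -- with `e_2`.
  have B : ∀ j, 1 ≤ j → j + 2 < k → j % 3 = 0 →
      X (j + 2) (k - (j + 2)) = X j (k - j) + X 2 (k - 2) := by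
    intro j hj hjk hj3
    have h := hX.jacobi_diag (s := 2) (by omega) hj (k := k) (by omega)
    rw [a_eq_one (j := j) (by omega), a_eq_neg_one (by omega), a_eq_one (by omega)] at h
    push_cast at h
    linear_combination h
  have C : ∀ m, 3 * m + 2 < k →
      X (3 * m + 2) (k - (3 * m + 2)) = (m + 1 : F) * X 2 (k - 2) := by
    intro m
    induction m with
    | zero => intro _; simp
    | succ m ih =>
      intro hm
      have h3 := A (3 * m + 2) (by omega) (by omega) (by omega)
      have h5 := B (3 * m + 3) (by omega) (by omega) (by omega)
      rw [show 3 * (m + 1) + 2 = 3 * m + 3 + 2 by ring, h5, h3, ih (by omega)]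
      push_cast
      ring
  have D : ∀ m, 3 * m + 4 < k →
      X (3 * m + 4) (k - (3 * m + 4)) = (m + 1 : F) * X 2 (k - 2) := by
    intro m hm
    rw [A (3 * m + 3) (by omega) (by omega) (by omega),
      A (3 * m + 2) (by omega) (by omega) (by omega), C m (by omega)]
  have h2 : X 2 (k - 2) = 0 := by
    obtain hk3 | hk3 : k = 3 ∨ 6 ≤ k := by omega
    · subst hk3
      rw [hX.skew, h1, neg_zero]
    · have h := D (k / 3 - 2) (by omega)
      rw [show 3 * (k / 3 - 2) + 4 = k - 2 by omega, hX.skew_diag (by omega)] at h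
      refine (mul_eq_zero.1 (?_ : ((k / 3 : ℕ) : F) * X 2 (k - 2) = 0)).resolve_left hkF
      obtain ⟨n, hn⟩ : ∃ n, k / 3 = n + 2 := ⟨k / 3 - 2, by omega⟩
      rw [hn, Nat.add_sub_cancel] at h
      rw [hn]
      push_cast
      linear_combination -h
  obtain h3 | h3 | h3 : i % 3 = 0 ∨ i % 3 = 1 ∨ i % 3 = 2 := by omega
  · have h := A (i - 1) (by omega) (by omega) (by omega)
    have h' := C (i / 3 - 1) (by omega)
    rw [show 3 * (i / 3 - 1) + 2 = i - 1 by omega, h2, mul_zero] at h'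
    rw [h', show i - 1 + 1 = i by omega] at h
    exact h
  · obtain rfl | hi1 : i = 1 ∨ 4 ≤ i := by omega
    · exact h1
    · have h' := D (i / 3 - 1) (by omega)
      rw [show 3 * (i / 3 - 1) + 4 = i by omega, h2, mul_zero] at h'
      exact h'
  · have h' := C (i / 3) (by omega)
    rw [show 3 * (i / 3) + 2 = i by omega, h2, mul_zero] at h'
    exact h'

/-- With `X_1 = 0`, residues 0 and 1 die at once. Residue 2 carries the constant value `X_2`, but
passing from `X_3` to `X_5` with `e_2` gives `-X_2`, hence `2 X_2 = 0`. -/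
theorem eq_zero_of_mod_one {k : ℕ} (hk : k % 3 = 1) (hF : (2 : F) ≠ 0)
    (h1 : X 1 (k - 1) = 0) (h7 : k = 7 → X 2 5 = 0) {i : ℕ} (hi : 1 ≤ i) (hik : i < k) :
    X i (k - i) = 0 := by
  have A1 : ∀ j, j % 3 = 1 → j + 1 < k → X j (k - j) = 0 := by
    intro j hj hjk
    have h := hX.jacobi_diag (s := 1) le_rfl (j := j) (by omega) (k := k) (by omega)
    rw [a_eq_zero (j := j) (by omega), a_eq_one (i := 1) (by omega), h1] at h
    push_cast at h
    linear_combination h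
  have A0 : ∀ j, 1 ≤ j → j % 3 = 0 → j < k → X j (k - j) = 0 := by
    intro j hj hj3 hjk
    have h := hX.jacobi_diag (s := 1) le_rfl (j := j - 1) (by omega) (k := k) (by omega)
    rw [a_eq_zero (j := k - 1 - (j - 1)) (by omega), a_eq_one (i := 1) (by omega), h1,
      show j - 1 + 1 = j by omega] at h
    push_cast at h
    linear_combination h
  have B2 : ∀ j, j % 3 = 2 → j + 2 < k → X j (k - j) = X 2 (k - 2) := by
    intro j hj hjk
    have h := hX.jacobi_diag (s := 2) (by omega) (j := j) (by omega) (k := k) (by omega)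
    rw [a_eq_zero (j := j) (by omega), a_eq_one (i := 2) (by omega),
      a_eq_one (i := j) (by omega)] at h
    push_cast at h
    linear_combination h
  have B0 : ∀ j, 3 ≤ j → j % 3 = 0 → j + 2 < k → X (j + 2) (k - (j + 2)) = -X 2 (k - 2) := by
    intro j hj hj3 hjk
    have h := hX.jacobi_diag (s := 2) (by omega) (j := j) (by omega) (k := k) (by omega)
    rw [a_eq_one (j := j) (by omega), a_eq_zero (j := k - 2 - j) (by omega),
      a_eq_neg_one (i := j) (by omega)] at h
    push_cast at h
    linear_combination h
  have h2 : 2 < k → X 2 (k - 2) = 0 := by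
    intro hk2
    refine (mul_eq_zero.1 (?_ : (2 : F) * X 2 (k - 2) = 0)).resolve_left hF
    obtain rfl | rfl | hk' : k = 4 ∨ k = 7 ∨ 10 ≤ k := by omega
    · have h := hX.skew 2 2
      simp only [Nat.reduceSub]
      linear_combination h
    -- In weight 7 the relation `X_5 = -X_2` is only skew-symmetry, and `X_5 = X_2` is out of range:
    -- hence the separate hypothesis.
    · simp [h7]
    · have h := B0 3 (by omega) (by omega) (by omega)
      rw [B2 5 (by omega) (by omega)] at h
      linear_combination h
  obtain h3 | h3 | h3 : i % 3 = 0 ∨ i % 3 = 1 ∨ i % 3 = 2 := by omega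
  · exact A0 i hi h3 hik
  · exact A1 i h3 (by omega)
  · obtain hi2 | hi2 : i + 2 < k ∨ i = k - 2 := by omega
    · rw [B2 i h3 hi2, h2 (by omega)]
    · rw [hi2, hX.skew_diag (by omega), h2 (by omega), neg_zero]

/-- Here `a_{1,k-1} = 0`, so the leading value is `X_2`. Its vanishing kills residue 0, and residue
2 follows by `i ↦ k - i`. Residue 1 is constant, while `X_4 = -X_1`, hence `2 X_1 = 0`. -/
theorem eq_zero_of_mod_two {k : ℕ} (hk : k % 3 = 2) (hF : (2 : F) ≠ 0)
    (h2 : X 2 (k - 2) = 0) (h5 : k = 5 → X 1 4 = 0) {i : ℕ} (hi : 1 ≤ i) (hik : i < k) :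
    X i (k - i) = 0 := by
  have A0 : ∀ j, 3 ≤ j → j % 3 = 0 → j + 1 < k → X (j + 1) (k - (j + 1)) = -X 1 (k - 1) := by
    intro j hj hj3 hjk
    have h := hX.jacobi_diag (s := 1) le_rfl (j := j) (by omega) (k := k) (by omega)
    rw [a_eq_neg_one (j := j) (by omega), a_eq_zero (i := 1) (by omega),
      a_eq_one (i := j) (by omega)] at h
    push_cast at h
    linear_combination -h
  have A1 : ∀ j, j % 3 = 1 → j + 1 < k → X j (k - j) = X 1 (k - 1) := by
    intro j hj hjk
    have h := hX.jacobi_diag (s := 1) le_rfl (j := j) (by omega) (k := k) (by omega)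
    rw [a_eq_zero (j := j) (by omega), a_eq_neg_one (i := 1) (by omega),
      a_eq_neg_one (i := j) (by omega)] at h
    push_cast at h
    linear_combination -h
  have h1 : X 1 (k - 1) = 0 := by
    refine (mul_eq_zero.1 (?_ : (2 : F) * X 1 (k - 1) = 0)).resolve_left hF
    obtain rfl | rfl | hk' : k = 2 ∨ k = 5 ∨ 8 ≤ k := by omega
    · have h := hX.skew 1 1
      simp only [Nat.reduceSub]
      linear_combination h
    -- In weight 5 the relation `X_4 = -X_1` is only skew-symmetry, so nothing forces `X_1` to
    -- vanish.
    · simp [h5]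
    · have h := A0 3 (by omega) (by omega) (by omega)
      rw [A1 4 (by omega) (by omega)] at h
      linear_combination h
  have B : ∀ j, 1 ≤ j → j % 3 = 0 → j < k → X j (k - j) = 0 := by
    intro j hj hj3 hjk
    have h := hX.jacobi_diag (s := 2) (by omega) (j := j - 2) (by omega) (k := k) (by omega)
    rw [a_eq_zero (j := k - 2 - (j - 2)) (by omega), a_eq_neg_one (i := 2) (by omega), h2,
      show j - 2 + 2 = j by omega] at h
    push_cast at h
    linear_combination -h
  obtain h3 | h3 | h3 : i % 3 = 0 ∨ i % 3 = 1 ∨ i % 3 = 2 := by omega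
  · exact B i hi h3 hik
  · obtain hi2 | hi2 : i + 1 < k ∨ i = k - 1 := by omega
    · rw [A1 i h3 hi2, h1]
    · rw [hi2, hX.skew_diag (by omega), h1, neg_zero]
  · have h := B (k - i) (by omega) (by omega) (by omega)
    rwa [hX.skew_diag (by omega), neg_eq_zero] at h

end IsCocycle

/-! ### Reduction to basis vectors and the explicit cocycles -/

section Basis

variable {F : Type*} [Field F] {p : ℕ}

theorem e_eq_zero {k : ℕ} (hk : k ∉ Icc 1 p) : (e k : G F p) = 0 := by
  refine ext_coord fun l hl => ?_
  rw [coord_e _ _ hl, map_zero, if_neg]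
  rintro rfl
  exact hk hl

/-- With `e_k = 0` beyond `p` the relations hold for all positive indices, which is what lets
truncated cocycles be treated as cocycles on `n₊(A₁⁽¹⁾)`. -/
theorem lie_e {i j : ℕ} (hi : 1 ≤ i) (hj : 1 ≤ j) :
    ⁅(e i : G F p), (e j : G F p)⁆ = (a i j : F) • e (i + j) := by
  by_cases hip : i ≤ p
  · by_cases hjp : j ≤ p
    · exact e_bracket i j (mem_Icc.2 ⟨hi, hip⟩) (mem_Icc.2 ⟨hj, hjp⟩)
    · rw [e_eq_zero (k := j) (by simp; omega), e_eq_zero (k := i + j) (by simp; omega), lie_zero,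
        smul_zero]
  · rw [e_eq_zero (k := i) (by simp; omega), e_eq_zero (k := i + j) (by simp; omega), zero_lie,
      smul_zero]

variable (F p) in
/-- The basis `e_1, …, e_p` of `𝔤(p)`. -/
def eBasis : Module.Basis ↥(Icc 1 p) F (G F p) := Pi.basisFun F ↥(Icc 1 p)

theorem eBasis_apply (i : ↥(Icc 1 p)) : eBasis F p i = e i.1 := by
  refine (Pi.basisFun_apply F _ i).trans ?_
  funext j
  simp only [e, Pi.single_apply, Subtype.ext_iff]

theorem alt2_zero_right (φ : G F p [⋀^Fin 2]→ₗ[F] F) (x : G F p) : φ ![x, 0] = 0 :=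
  φ.map_coord_zero 1 rfl

theorem alt2_eq_zero {φ : G F p [⋀^Fin 2]→ₗ[F] F}
    (h : ∀ i ∈ Icc 1 p, ∀ j ∈ Icc 1 p, φ ![e i, e j] = 0) : φ = 0 := by
  refine (eBasis F p).ext_alternating fun v _ => ?_
  have hv : (fun i => eBasis F p (v i)) = ![e (v 0).1, e (v 1).1] := by
    funext i
    fin_cases i <;> exact eBasis_apply _
  rw [hv, h _ (v 0).2 _ (v 1).2]
  rfl

theorem alt2_left_eq_zero {φ : G F p [⋀^Fin 2]→ₗ[F] F} {x : G F p}
    (h : ∀ i ∈ Icc 1 p, φ ![e i, x] = 0) (g : G F p) : φ ![g, x] = 0 := by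
  let f : Module.Dual F (G F p) :=
    { toFun := fun g => φ ![g, x]
      map_add' := fun g g' => alt2_add_left φ g g' x
      map_smul' := fun c g => alt2_smul_left φ c g x }
  have hf : f = 0 := (eBasis F p).ext fun i => by
    rw [eBasis_apply]
    exact h i.1 i.2
  exact congrArg (fun f : Module.Dual F (G F p) => f g) hf

theorem d1_apply_e (ψ : Module.Dual F (G F p)) {i j : ℕ} (hi : 1 ≤ i) (hj : 1 ≤ j) :
    d1 F (G F p) ψ ![e i, e j] = a i j * ψ (e (i + j)) := by
  change ψ ⁅(e i : G F p), (e j : G F p)⁆ = _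
  rw [lie_e hi hj, map_smul, smul_eq_mul]

theorem d2_apply_e (φ : G F p [⋀^Fin 2]→ₗ[F] F) {i j l : ℕ} (hi : 1 ≤ i) (hj : 1 ≤ j)
    (hl : 1 ≤ l) :
    d2 F (G F p) φ ![e i, e j, e l] = a i j * φ ![e (i + j), e l] -
      a i l * φ ![e (i + l), e j] + a j l * φ ![e (j + l), e i] := by
  change φ ![⁅(e i : G F p), (e j : G F p)⁆, e l] - φ ![⁅(e i : G F p), (e l : G F p)⁆, e j] +
    φ ![⁅(e j : G F p), (e l : G F p)⁆, e i] = _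
  rw [lie_e hi hj, lie_e hi hl, lie_e hj hl]
  simp only [alt2_smul_left]

theorem isCocycle_of_d2_eq_zero {φ : G F p [⋀^Fin 2]→ₗ[F] F} (h : d2 F (G F p) φ = 0) :
    IsCocycle fun i j => φ ![e i, e j] where
  skew i j := alt2_swap φ _ _
  jacobi i j l hi hj hl := by
    rw [← d2_apply_e φ hi hj hl, h]
    rfl

theorem d2_eq_zero {φ : G F p [⋀^Fin 2]→ₗ[F] F}
    (h : ∀ i j l, 1 ≤ i → 1 ≤ j → 1 ≤ l → i ≠ j → i ≠ l → j ≠ l →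
      (a i j : F) * φ ![e (i + j), e l] - a i l * φ ![e (i + l), e j] +
        a j l * φ ![e (j + l), e i] = 0) : d2 F (G F p) φ = 0 := by
  refine (eBasis F p).ext_alternating fun v hv => ?_
  have hv' : (fun i => eBasis F p (v i)) = ![e (v 0).1, e (v 1).1, e (v 2).1] := by
    funext i
    fin_cases i <;> exact eBasis_apply _
  have hne : ∀ i j, i ≠ j → (v i).1 ≠ (v j).1 := fun i j hij h => hij (hv (Subtype.ext h))
  have h1 : ∀ i, 1 ≤ (v i).1 := fun i => (mem_Icc.1 (v i).2).1
  rw [hv', d2_apply_e φ (h1 0) (h1 1) (h1 2), h _ _ _ (h1 0) (h1 1) (h1 2)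
    (hne 0 1 (by decide)) (hne 0 2 (by decide)) (hne 1 2 (by decide))]
  rfl

/-! ### Values of the explicit cochains on basis vectors -/

theorem eDual_apply_e {i j : ℕ} (hi : i ∈ Icc 1 p) (hj : j ∈ Icc 1 p) (k l : ℕ) :
    (eDual i j : G F p [⋀^Fin 2]→ₗ[F] F) ![e k, e l] =
      (if i = k then 1 else 0) * (if j = l then 1 else 0) -
        (if j = k then 1 else 0) * (if i = l then 1 else 0) := by
  change coord i (e k : G F p) * coord j (e l : G F p) -
    coord j (e k : G F p) * coord i (e l : G F p) = _
  simp only [coord_e _ _ hi, coord_e _ _ hj]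

theorem eDual_apply_e_self {i j : ℕ} (hi : i ∈ Icc 1 p) (hj : j ∈ Icc 1 p) (hij : i ≠ j) :
    (eDual i j : G F p [⋀^Fin 2]→ₗ[F] F) ![e i, e j] = 1 := by
  simp [eDual_apply_e hi hj, hij]

theorem eDual_apply_e_of_ne {i j : ℕ} (hi : i ∈ Icc 1 p) (hj : j ∈ Icc 1 p) {k l : ℕ}
    (h1 : i = k → j ≠ l) (h2 : j = k → i ≠ l) :
    (eDual i j : G F p [⋀^Fin 2]→ₗ[F] F) ![e k, e l] = 0 := by
  rw [eDual_apply_e hi hj]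
  by_cases hik : i = k
  · by_cases hjk : j = k
    · rw [if_neg (h1 hik), if_neg (h2 hjk)]; simp
    · rw [if_neg (h1 hik), if_neg hjk]; simp
  · by_cases hjk : j = k
    · rw [if_neg hik, if_neg (h2 hjk)]; simp
    · rw [if_neg hik, if_neg hjk]; simp

theorem mem_Icc_idx {k i : ℕ} (hk : k ≤ p + 1) :
    i ∈ Icc (idxM p k) (idxS k) ↔ 1 ≤ i ∧ 2 * i < k := by
  rw [idxM, if_pos hk, idxS, mem_Icc]
  split_ifs with h
  · obtain ⟨m, rfl⟩ := h
    omega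
  · obtain ⟨m, rfl⟩ := Nat.not_even_iff_odd.1 h
    omega

/-- On basis vectors `φ_k` is the coefficient of `e_k` in the untruncated bracket; this remains
meaningful for `k = p + 1`. -/
theorem phi_apply_e {k : ℕ} (hk : k ≤ p + 1) {i j : ℕ} (hi : 1 ≤ i) (hj : 1 ≤ j) :
    (phi k : G F p [⋀^Fin 2]→ₗ[F] F) ![e i, e j] = if i + j = k then (a i j : F) else 0 := by
  have hsum : (phi k : G F p [⋀^Fin 2]→ₗ[F] F) ![e i, e j] =
      ∑ m ∈ Icc (idxM p k) (idxS k), (a m (k - m) : F) *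
        (eDual m (k - m) : G F p [⋀^Fin 2]→ₗ[F] F) ![e i, e j] := by
    let f : (G F p [⋀^Fin 2]→ₗ[F] F) →+ F :=
      { toFun := fun φ => φ ![e i, e j], map_zero' := rfl, map_add' := fun _ _ => rfl }
    exact map_sum f _ _
  have hm1 : ∀ m ∈ Icc (idxM p k) (idxS k), m ∈ Icc 1 p ∧ k - m ∈ Icc 1 p := by
    intro m hm
    rw [mem_Icc_idx hk] at hm
    simp only [mem_Icc]
    omega
  rw [hsum]
  split_ifs with h
  · subst h
    obtain hij | rfl | hij := lt_trichotomy i j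
    · rw [sum_eq_single i]
      · have hi' : i ∈ Icc (idxM p (i + j)) (idxS (i + j)) := by rw [mem_Icc_idx hk]; omega
        have h1 := hm1 i hi'
        rw [Nat.add_sub_cancel_left] at h1 ⊢
        rw [eDual_apply_e_self h1.1 h1.2 (by omega), mul_one]
      · intro m hm hne
        have hm2 := (mem_Icc_idx hk).1 hm
        rw [eDual_apply_e_of_ne (hm1 m hm).1 (hm1 m hm).2 (by omega) (by omega), mul_zero]
      · intro hn
        exact absurd ((mem_Icc_idx hk).2 ⟨hi, by omega⟩) hn
    · rw [a_self, Int.cast_zero]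
      refine sum_eq_zero fun m hm => ?_
      rw [alt2_self, mul_zero]
    · rw [sum_eq_single j]
      · have hj' : j ∈ Icc (idxM p (i + j)) (idxS (i + j)) := by rw [mem_Icc_idx hk]; omega
        have h1 := hm1 j hj'
        rw [Nat.add_sub_cancel] at h1 ⊢
        rw [alt2_swap, eDual_apply_e_self h1.1 h1.2 (by omega), a_skew j i]
        push_cast
        ring
      · intro m hm hne
        have hm2 := (mem_Icc_idx hk).1 hm
        rw [eDual_apply_e_of_ne (hm1 m hm).1 (hm1 m hm).2 (by omega) (by omega), mul_zero]
      · intro hn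
        exact absurd ((mem_Icc_idx hk).2 ⟨hj, by omega⟩) hn
  · refine sum_eq_zero fun m hm => ?_
    have hm2 := (mem_Icc_idx hk).1 hm
    rw [eDual_apply_e_of_ne (hm1 m hm).1 (hm1 m hm).2 (by omega) (by omega), mul_zero]

/-- Evaluated in weight `k`, closedness is the Jacobi identity `a_jacobi` for the structure
constants. -/
theorem d2_phi {k : ℕ} (hk : k ≤ p + 1) : d2 F (G F p) (phi k) = 0 := by
  refine d2_eq_zero fun i j l hi hj hl _ _ _ => ?_
  rw [phi_apply_e hk (by omega) hl, phi_apply_e hk (by omega) hj, phi_apply_e hk (by omega) hi]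
  by_cases h : i + j + l = k
  · rw [if_pos h, if_pos (by omega), if_pos (by omega)]
    have := congrArg (Int.cast : ℤ → F) (a_jacobi i j l)
    rw [a_skew (j + l) i, a_skew (i + l) j] at this
    push_cast at this
    linear_combination -this
  · rw [if_neg h, if_neg (by omega), if_neg (by omega)]
    ring

/-- A nonzero term needs `i + j = 4` and `l = 1` up to order, which no three distinct positive
indices satisfy. -/
theorem d2_eDual_one_four (hp : 4 ≤ p) : d2 F (G F p) (eDual 1 4) = 0 := by
  have h1 : (1 : ℕ) ∈ Icc 1 p := by simp; omega
  have h4 : (4 : ℕ) ∈ Icc 1 p := by simp; omega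
  refine d2_eq_zero fun i j l hi hj hl hij hil hjl => ?_
  rw [eDual_apply_e_of_ne h1 h4 (by omega) (by omega),
    eDual_apply_e_of_ne h1 h4 (by omega) (by omega),
    eDual_apply_e_of_ne h1 h4 (by omega) (by omega)]
  ring

/-- The only distinct indices reaching `e_5 ∧ e_2` are `{i, j} = {1, 4}` with `l = 2`, and there
`a_{1,4} = 0`. -/
theorem a_mul_eDual_two_five (hp : 5 ≤ p) {i j l : ℕ} (hi : 1 ≤ i) (hj : 1 ≤ j)
    (hij : i ≠ j) (hil : i ≠ l) (hjl : j ≠ l) :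
    (a i j : F) * (eDual 2 5 : G F p [⋀^Fin 2]→ₗ[F] F) ![e (i + j), e l] = 0 := by
  by_cases h : i + j = 5 ∧ l = 2 ∧ (i = 1 ∨ j = 1)
  · have h0 : a i j = 0 := by
      refine a_eq_zero ?_
      omega
    rw [h0, Int.cast_zero, zero_mul]
  · rw [eDual_apply_e_of_ne (by simp; omega) (by simp; omega) (by omega) (by omega), mul_zero]

theorem d2_eDual_two_five (hp : 5 ≤ p) : d2 F (G F p) (eDual 2 5) = 0 := by
  refine d2_eq_zero fun i j l hi hj hl hij hil hjl => ?_
  rw [a_mul_eDual_two_five hp hi hj hij hil hjl,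
    a_mul_eDual_two_five hp hi hl hil hij hjl.symm,
    a_mul_eDual_two_five hp hj hl hjl hij.symm hil.symm]
  ring

end Basis

/-! ### Coordinate functionals and the kernel of `d²_*` -/

section Kernel

variable {F : Type*} [Field F] {p : ℕ}

theorem tilde_e (hp : 5 ≤ p) (φ : G F p [⋀^Fin 2]→ₗ[F] F) (k : ℕ) : tilde hp φ (e k) = 0 := by
  by_cases hk : k ∈ Icc 1 p
  · exact (tilde_spec hp φ).2 k hk
  · rw [e_eq_zero hk, ← zero_smul F (0 : G F p), (tilde_spec hp φ).1.1, zero_pow (by omega),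
      zero_mul]

theorem C2Star.eq_zero (hp : 5 ≤ p) {c : C2Star F (G F p) p}
    (hφ : ∀ i ∈ Icc 1 p, ∀ j ∈ Icc 1 p, c.1.1 ![e i, e j] = 0)
    (hω : ∀ k ∈ Icc 1 p, c.1.2 (e k) = 0) : c = 0 := by
  have h1 : c.1.1 = 0 := alt2_eq_zero hφ
  have h2 : c.1.2 = 0 :=
    (existsUnique_tilde hp c.1.1).unique ⟨c.2, hω⟩
      ⟨by rw [h1]; exact (compatiblePairs₂ F (G F p) p).zero_mem, fun _ _ => rfl⟩
  exact Subtype.ext (Prod.ext h1 h2)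

/-- The functional `(φ, ω) ↦ φ(e_i ∧ e_j)`. -/
def formEval (i j : ℕ) : C2Star F (G F p) p →ₗ[F] F where
  toFun c := c.1.1 ![e i, e j]
  map_add' _ _ := rfl
  map_smul' _ _ := rfl

/-- The functional `(φ, ω) ↦ ω(e_k)`. -/
def opEval (k : ℕ) : C2Star F (G F p) p →ₗ[F] F where
  toFun c := c.1.2 (e k)
  map_add' _ _ := rfl
  map_smul' _ _ := rfl

/-- An index `i` for which `a_{i,k-i} ≠ 0`. -/
def leadIdx (k : ℕ) : ℕ := if k % 3 = 2 then 2 else 1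

theorem leadIdx_pos (k : ℕ) : 1 ≤ leadIdx k := by
  unfold leadIdx; split_ifs <;> omega

theorem leadIdx_lt {k : ℕ} (hk : 3 ≤ k) : leadIdx k < k := by
  unfold leadIdx; split_ifs <;> omega

theorem a_leadIdx_mul_self {k : ℕ} (hk : 3 ≤ k) :
    a (leadIdx k) (k - leadIdx k) * a (leadIdx k) (k - leadIdx k) = 1 := by
  unfold leadIdx
  split_ifs with h
  · rw [a_eq_one (by omega)]; rfl
  · obtain h | h : k % 3 = 0 ∨ k % 3 = 1 := by omega
    · rw [a_eq_one (by omega)]; rfl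
    · rw [a_eq_neg_one (by omega)]; rfl

/-- The functional that reads off the coefficient of `φ_k`. -/
def phiCoeff (k : ℕ) : C2Star F (G F p) p →ₗ[F] F :=
  (a (leadIdx k) (k - leadIdx k) : F) • formEval (leadIdx k) (k - leadIdx k)

theorem phiCoeff_apply (k : ℕ) (c : C2Star F (G F p) p) :
    phiCoeff k c = (a (leadIdx k) (k - leadIdx k) : F) * c.1.1 ![e (leadIdx k), e (k - leadIdx k)] :=
  rfl

theorem phiCoeff_of_form {k : ℕ} (hk : 3 ≤ k) {c : C2Star F (G F p) p} (r : F)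
    (h : c.1.1 ![e (leadIdx k), e (k - leadIdx k)] = a (leadIdx k) (k - leadIdx k) * r) :
    phiCoeff k c = r := by
  have := congrArg (Int.cast : ℤ → F) (a_leadIdx_mul_self hk)
  push_cast at this
  rw [phiCoeff_apply, h]
  linear_combination r * this

theorem phiCoeff_phi (hp : 5 ≤ p) {k l : ℕ} (hk : 3 ≤ k) (hl : l ≤ p + 1) :
    phiCoeff k (tildePair hp (phi l) : C2Star F (G F p) p) = if k = l then 1 else 0 := by
  refine phiCoeff_of_form hk _ ?_
  have h1 := leadIdx_lt hk
  refine (phi_apply_e hl (leadIdx_pos k) (by omega)).trans ?_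
  rw [mul_ite, mul_one, mul_zero, Nat.add_sub_cancel' h1.le]

/-- In weight 5 the coefficient is read off at `(2, 3)`, not at `(1, 4)`; likewise in weight 7 at
`(1, 6)`, not at `(2, 5)`. -/
theorem phiCoeff_eDual_one_four (hp : 5 ≤ p) (k : ℕ) :
    phiCoeff k (tildePair hp (eDual 1 4) : C2Star F (G F p) p) = 0 := by
  refine mul_eq_zero_of_right _ (eDual_apply_e_of_ne (by simp; omega) (by simp; omega) ?_ ?_) <;>
  · unfold leadIdx
    split_ifs <;> omega

theorem phiCoeff_eDual_two_five (hp : 5 ≤ p) (k : ℕ) :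
    phiCoeff k (tildePair hp (eDual 2 5) : C2Star F (G F p) p) = 0 := by
  refine mul_eq_zero_of_right _ (eDual_apply_e_of_ne (by simp; omega) (by simp; omega) ?_ ?_) <;>
  · unfold leadIdx
    split_ifs <;> omega

theorem natCast_ne_zero [CharP F p] {n : ℕ} (h0 : 0 < n) (hn : n < p) : (n : F) ≠ 0 := by
  rw [Ne, CharP.cast_eq_zero_iff F p]
  exact fun h => absurd (Nat.le_of_dvd h0 h) (by omega)

variable [Fact p.Prime] [CharP F p]

theorem prime_mod_three (hp : 5 ≤ p) (hp3 : p % 3 ≠ 2) : p % 3 = 1 := by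
  have h0 : p % 3 ≠ 0 := fun h =>
    absurd ((Nat.prime_dvd_prime_iff_eq Nat.prime_three Fact.out).1 (Nat.dvd_of_mod_eq_zero h))
      (by omega)
  omega

theorem d2_eq_zero_of_mem_ker {hp : 5 ≤ p} {lam : ↥(Icc 1 p) → F} {c : C2Star F (G F p) p}
    (hc : c ∈ LinearMap.ker (d2Star hp lam)) : d2 F (G F p) c.1.1 = 0 :=
  congrArg (fun z : C3Star F (G F p) p => z.1.1) (LinearMap.mem_ker.1 hc)

theorem tildePair_mem_ker (hp : 5 ≤ p) (lam : ↥(Icc 1 p) → F) {φ : G F p [⋀^Fin 2]→ₗ[F] F}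
    (h : d2 F (G F p) φ = 0) (h' : ∀ i ∈ Icc 1 p, φ ![e i, e p] = 0) :
    tildePair hp φ ∈ LinearMap.ker (d2Star hp lam) := by
  refine LinearMap.mem_ker.2 (Subtype.ext (Prod.ext h ?_))
  funext g x
  change φ ![g, pOp lam x] = 0
  rw [pOp, alt2_smul_right, alt2_left_eq_zero h', mul_zero]

theorem eBarPair_mem_ker (hp : 5 ≤ p) (lam : ↥(Icc 1 p) → F) (k : ℕ) :
    eBarPair hp k ∈ LinearMap.ker (d2Star hp lam) :=
  LinearMap.mem_ker.2 (Subtype.ext (Prod.ext (map_zero (d2 F (G F p))) rfl))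

/-- Only `φ_{p+1}` could pair nontrivially with `e_p`, through `a_{1,p}`, which is zero because `p ≡
1` modulo 3. -/
theorem phi_mem_ker (hp : 5 ≤ p) (hp3 : p % 3 ≠ 2) (lam : ↥(Icc 1 p) → F) {k : ℕ}
    (hk : k ≤ p + 1) : tildePair hp (phi k) ∈ LinearMap.ker (d2Star hp lam) := by
  refine tildePair_mem_ker hp lam (d2_phi hk) fun i hi => ?_
  have h1 := (mem_Icc.1 hi).1
  rw [phi_apply_e hk h1 (by omega)]
  split_ifs with h
  · obtain rfl : i = 1 := by omega
    have := prime_mod_three hp hp3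
    rw [a_eq_zero (by omega), Int.cast_zero]
  · rfl

theorem seven_le (hp : 5 ≤ p) (hp3 : p % 3 ≠ 2) : 7 ≤ p := by
  have := prime_mod_three hp hp3
  have h6 : p ≠ 6 := by
    rintro rfl
    omega
  omega

theorem eDual_one_four_mem_ker (hp : 5 ≤ p) (lam : ↥(Icc 1 p) → F) :
    tildePair hp (eDual 1 4) ∈ LinearMap.ker (d2Star hp lam) :=
  tildePair_mem_ker hp lam (d2_eDual_one_four (by omega)) fun i _ =>
    eDual_apply_e_of_ne (by simp; omega) (by simp; omega) (by omega) (by omega)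

theorem eDual_two_five_mem_ker (hp : 5 ≤ p) (hp3 : p % 3 ≠ 2) (lam : ↥(Icc 1 p) → F) :
    tildePair hp (eDual 2 5) ∈ LinearMap.ker (d2Star hp lam) := by
  have := seven_le hp hp3
  exact tildePair_mem_ker hp lam (d2_eDual_two_five hp) fun i _ =>
    eDual_apply_e_of_ne (by simp; omega) (by simp; omega) (by omega) (by omega)

/-- The separation statement behind both bases. Of membership in the kernel it uses only `d2 φ = 0`.
-/
theorem eq_zero_of_mem_ker (hp : 5 ≤ p) (hp3 : p % 3 ≠ 2) {lam : ↥(Icc 1 p) → F}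
    {c : C2Star F (G F p) p} (hc : c ∈ LinearMap.ker (d2Star hp lam))
    (h14 : formEval 1 4 c = 0) (h25 : formEval 2 5 c = 0)
    (hphi : ∀ k ∈ Icc 3 (p + 1), phiCoeff k c = 0) (hop : ∀ k ∈ Icc 1 p, opEval k c = 0) :
    c = 0 := by
  have hX := isCocycle_of_d2_eq_zero (d2_eq_zero_of_mem_ker hc)
  have h3 := prime_mod_three hp hp3
  have h2F : (2 : F) ≠ 0 := by
    have := natCast_ne_zero (F := F) (p := p) (n := 2) (by omega) (by omega)
    simpa using this
  have hlead : ∀ k, 3 ≤ k → c.1.1 ![e (leadIdx k), e (k - leadIdx k)] = 0 := by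
    intro k hk
    by_cases hkp : k ≤ p + 1
    · have h := hphi k (mem_Icc.2 ⟨hk, hkp⟩)
      have ha := congrArg (Int.cast : ℤ → F) (a_leadIdx_mul_self hk)
      push_cast at ha
      rw [phiCoeff_apply] at h
      linear_combination (a (leadIdx k) (k - leadIdx k) : F) * h -
        c.1.1 ![e (leadIdx k), e (k - leadIdx k)] * ha
    -- The partner index exceeds `p`. This is clear when `leadIdx k = 1`; when it is 2, `k ≡ 2`
    -- while `p + 2 ≡ 0` modulo 3, so `k ≠ p + 2`.
    · rw [e_eq_zero (k := k - leadIdx k), alt2_zero_right]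
      unfold leadIdx
      split_ifs <;> simp <;> omega
  refine C2Star.eq_zero hp (fun i hi j hj => ?_) hop
  rw [mem_Icc] at hi hj
  by_cases hij : i = j
  · rw [hij, alt2_self]
  have hk3 : 3 ≤ i + j := by omega
  have hl := hlead (i + j) hk3
  have key : c.1.1 ![e i, e (i + j - i)] = 0 := by
    obtain h | h | h : (i + j) % 3 = 0 ∨ (i + j) % 3 = 1 ∨ (i + j) % 3 = 2 := by omega
    · rw [leadIdx, if_neg (by omega)] at hl
      -- Since `i + j ≤ 2p`, the integer `(i + j) / 3` lies strictly between 0 and `p`, so it is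
      -- invertible in `F`.
      exact hX.eq_zero_of_mod_zero h (natCast_ne_zero (p := p) (by omega) (by omega)) hl hi.1
        (by omega)
    · rw [leadIdx, if_neg (by omega)] at hl
      exact hX.eq_zero_of_mod_one h h2F hl (fun _ => h25) hi.1 (by omega)
    · rw [leadIdx, if_pos h] at hl
      exact hX.eq_zero_of_mod_two h h2F hl (fun _ => h14) hi.1 (by omega)
  rwa [Nat.add_sub_cancel_left] at key

end Kernel

/-! ### Dual bases of the kernel and of `H²_*` -/

section Cohomology

variable {F : Type*} [Field F] {p : ℕ}

theorem dualBases_of_apply {R M ι : Type*} [CommRing R] [AddCommGroup M] [Module R M] [Finite ι]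
    [DecidableEq ι] {v : ι → M} {f : ι → Module.Dual R M}
    (h : ∀ s t, f s (v t) = if s = t then 1 else 0) (h0 : ∀ m, (∀ s, f s m = 0) → m = 0) :
    Module.DualBases v f where
  eval_same s := by rw [h, if_pos rfl]
  eval_of_ne s t hst := (h s t).trans (if_neg hst)
  total {m m'} hm := sub_eq_zero.1 (h0 _ fun s => by rw [map_sub, hm, sub_self])

theorem opEval_tildePair (hp : 5 ≤ p) (k : ℕ) (φ : G F p [⋀^Fin 2]→ₗ[F] F) :
    opEval k (tildePair hp φ) = 0 :=
  tilde_e hp φ k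

theorem formEval_one_four_phi (hp : 5 ≤ p) {k : ℕ} (hk : k ≤ p + 1) :
    formEval 1 4 (tildePair hp (phi k) : C2Star F (G F p) p) = 0 := by
  refine (phi_apply_e hk le_rfl (by omega)).trans ?_
  rw [a_eq_zero (by omega), Int.cast_zero, ite_self]

theorem formEval_two_five_phi (hp : 5 ≤ p) {k : ℕ} (hk : k ≤ p + 1) :
    formEval 2 5 (tildePair hp (phi k) : C2Star F (G F p) p) = 0 := by
  refine (phi_apply_e hk (by omega) (by omega)).trans ?_
  rw [a_eq_zero (by omega), Int.cast_zero, ite_self]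

theorem formEval_one_four_eDual (hp : 5 ≤ p) :
    formEval 1 4 (tildePair hp (eDual 1 4) : C2Star F (G F p) p) = 1 :=
  eDual_apply_e_self (by simp; omega) (by simp; omega) (by omega)

theorem formEval_two_five_eDual (hp : 5 ≤ p) :
    formEval 2 5 (tildePair hp (eDual 2 5) : C2Star F (G F p) p) = 1 :=
  eDual_apply_e_self (by simp; omega) (by simp; omega) (by omega)

theorem formEval_one_four_eDual_two_five (hp : 5 ≤ p) :
    formEval 1 4 (tildePair hp (eDual 2 5) : C2Star F (G F p) p) = 0 :=
  eDual_apply_e_of_ne (by simp; omega) (by simp; omega) (by omega) (by omega)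

theorem formEval_two_five_eDual_one_four (hp : 5 ≤ p) :
    formEval 2 5 (tildePair hp (eDual 1 4) : C2Star F (G F p) p) = 0 :=
  eDual_apply_e_of_ne (by simp; omega) (by simp; omega) (by omega) (by omega)

/-- The index of `kerVec` belonging to `φ_k`. -/
def phiIdx (k : ℕ) (hk : k ∈ Icc 3 (p + 1)) : Fin 2 ⊕ ↥(Icc 3 (p + 1)) ⊕ ↥(Icc 1 p) :=
  Sum.inr (Sum.inl ⟨k, hk⟩)

theorem succ_mem_Icc (hp : 5 ≤ p) : p + 1 ∈ Icc 3 (p + 1) :=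
  mem_Icc.2 ⟨by omega, le_rfl⟩

/-- The embedding of the index set of the basis of `H²_*` into that of the basis of
`ker d²_*`. -/
def cohIdx (hp : 5 ≤ p) : Fin 3 ⊕ ↥(Icc 1 p) → Fin 2 ⊕ ↥(Icc 3 (p + 1)) ⊕ ↥(Icc 1 p) :=
  Sum.elim ![Sum.inl 0, Sum.inl 1, phiIdx (p + 1) (succ_mem_Icc hp)]
    fun k => Sum.inr (Sum.inr k)

theorem cohIdx_injective (hp : 5 ≤ p) : Function.Injective (cohIdx hp) := by
  rintro (s | s) (t | t) h
  · fin_cases s <;> fin_cases t <;> simp_all [cohIdx, phiIdx]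
  · fin_cases s <;> simp_all [cohIdx, phiIdx]
  · fin_cases t <;> simp_all [cohIdx, phiIdx]
  · simpa [cohIdx] using h

/-- `φ_p` is not among the representatives, so subtracting multiples of its coordinate does not
disturb biorthogonality. -/
theorem phiIdx_ne_cohIdx (hp : 5 ≤ p) (t : Fin 3 ⊕ ↥(Icc 1 p)) :
    phiIdx p (mem_Icc.2 ⟨by omega, by omega⟩) ≠ cohIdx hp t := by
  rcases t with t | t
  · fin_cases t <;> simp [cohIdx, phiIdx]
  · simp [cohIdx, phiIdx]

variable [Fact p.Prime] [CharP F p]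

theorem opEval_eBarPair (hp : 5 ≤ p) {k l : ℕ} (hl : l ∈ Icc 1 p) :
    opEval k (eBarPair hp l : C2Star F (G F p) p) = if k = l then 1 else 0 := by
  change coord l (e k : G F p) ^ p = _
  rw [coord_e _ _ hl, ite_pow, one_pow, zero_pow (by omega)]
  exact if_congr eq_comm rfl rfl

theorem phiCoeff_eBarPair (hp : 5 ≤ p) (k l : ℕ) :
    phiCoeff k (eBarPair hp l : C2Star F (G F p) p) = 0 :=
  mul_zero _

theorem formEval_eBarPair (hp : 5 ≤ p) (i j k : ℕ) :
    formEval i j (eBarPair hp k : C2Star F (G F p) p) = 0 :=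
  rfl

/-! ### The basis of `ker d²_*` -/

variable (hp : 5 ≤ p) (hp3 : p % 3 ≠ 2) (lam : ↥(Icc 1 p) → F)

/-- The explicit cocycles that span `ker d²_*`. -/
def kerVec : Fin 2 ⊕ ↥(Icc 3 (p + 1)) ⊕ ↥(Icc 1 p) → LinearMap.ker (d2Star hp lam) :=
  Sum.elim ![⟨_, eDual_one_four_mem_ker hp lam⟩, ⟨_, eDual_two_five_mem_ker hp hp3 lam⟩]
    (Sum.elim (fun k => ⟨_, phi_mem_ker hp hp3 lam (mem_Icc.1 k.2).2⟩)
      fun k => ⟨_, eBarPair_mem_ker hp lam k⟩)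

/-- The coordinate functionals of the basis `kerVec`. -/
def kerCoord : Fin 2 ⊕ ↥(Icc 3 (p + 1)) ⊕ ↥(Icc 1 p) →
    Module.Dual F (LinearMap.ker (d2Star hp lam)) := fun s =>
  (Sum.elim ![formEval 1 4, formEval 2 5]
    (Sum.elim (fun k => phiCoeff k.1) fun k => opEval k.1) s : C2Star F (G F p) p →ₗ[F] F) ∘ₗ
    (LinearMap.ker (d2Star hp lam)).subtype

theorem kerCoord_kerVec (s t : Fin 2 ⊕ ↥(Icc 3 (p + 1)) ⊕ ↥(Icc 1 p)) :
    kerCoord hp lam s (kerVec hp hp3 lam t) = if s = t then 1 else 0 := by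
  rcases s with s | s | s <;> rcases t with t | t | t
  · fin_cases s <;> fin_cases t
    · exact formEval_one_four_eDual hp
    · exact formEval_one_four_eDual_two_five hp
    · exact formEval_two_five_eDual_one_four hp
    · exact formEval_two_five_eDual hp
  · fin_cases s
    · exact formEval_one_four_phi hp (mem_Icc.1 t.2).2
    · exact formEval_two_five_phi hp (mem_Icc.1 t.2).2
  · fin_cases s
    · exact formEval_eBarPair hp 1 4 t
    · exact formEval_eBarPair hp 2 5 t
  · fin_cases t
    · exact phiCoeff_eDual_one_four hp _
    · exact phiCoeff_eDual_two_five hp _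
  · refine (phiCoeff_phi hp (mem_Icc.1 s.2).1 (mem_Icc.1 t.2).2).trans ?_
    simp only [Sum.inr.injEq, Sum.inl.injEq, Subtype.ext_iff]
  · exact phiCoeff_eBarPair hp _ _
  · fin_cases t <;> exact opEval_tildePair hp _ _
  · exact opEval_tildePair hp _ _
  · refine (opEval_eBarPair hp t.2).trans ?_
    simp only [Sum.inr.injEq, Subtype.ext_iff]

include hp3 in
theorem eq_zero_of_kerCoord {c : LinearMap.ker (d2Star hp lam)}
    (h : ∀ s, kerCoord hp lam s c = 0) : c = 0 :=
  Subtype.ext (eq_zero_of_mem_ker hp hp3 c.2 (h (Sum.inl 0)) (h (Sum.inl 1))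
    (fun k hk => h (Sum.inr (Sum.inl ⟨k, hk⟩))) fun k hk => h (Sum.inr (Sum.inr ⟨k, hk⟩)))

theorem dualBases_kerVec : Module.DualBases (kerVec hp hp3 lam) (kerCoord hp lam) :=
  dualBases_of_apply (kerCoord_kerVec hp hp3 lam) fun _ => eq_zero_of_kerCoord hp hp3 lam

/-! ### The basis of `H²_*` -/

theorem formEval_d1Star (ψ : Module.Dual F (G F p)) {i j : ℕ} (hi : 1 ≤ i) (hj : 1 ≤ j) :
    formEval i j (d1Star hp lam ψ) = a i j * ψ (e (i + j)) :=
  d1_apply_e ψ hi hj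

theorem phiCoeff_d1Star (ψ : Module.Dual F (G F p)) {k : ℕ} (hk : 3 ≤ k) :
    phiCoeff k (d1Star hp lam ψ) = ψ (e k) := by
  refine phiCoeff_of_form hk _ ?_
  have h1 := leadIdx_lt hk
  refine (d1_apply_e ψ (leadIdx_pos k) (by omega)).trans ?_
  rw [Nat.add_sub_cancel' h1.le]

theorem opEval_d1Star (ψ : Module.Dual F (G F p)) (k : ↥(Icc 1 p)) :
    opEval k.1 (d1Star hp lam ψ) = lam k * ψ (e p) := by
  change ψ (pOp lam (e k.1)) = _
  have h : ∑ i : ↥(Icc 1 p), coord i.1 (e k.1 : G F p) ^ p * lam i = lam k := by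
    rw [sum_eq_single k]
    · rw [coord_e _ _ k.2, if_pos rfl, one_pow, one_mul]
    · intro i _ hik
      rw [coord_e _ _ i.2, if_neg fun h => hik (Subtype.ext h), zero_pow (by omega), zero_mul]
    · intro h
      exact absurd (mem_univ k) h
  rw [pOp, h, map_smul, smul_eq_mul]

theorem d1Star_mem_ker (ψ : Module.Dual F (G F p)) :
    d1Star hp lam ψ ∈ LinearMap.ker (d2Star hp lam) :=
  LinearMap.mem_ker.2 (d2Star_d1Star hp lam ψ)

/-- The functionals on `ker d²_*` that induce the coordinate functionals on `H²_*`. -/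
def cohCoord : Fin 3 ⊕ ↥(Icc 1 p) → Module.Dual F (LinearMap.ker (d2Star hp lam)) :=
  Sum.elim (fun i => kerCoord hp lam (cohIdx hp (Sum.inl i))) fun k =>
    kerCoord hp lam (cohIdx hp (Sum.inr k)) -
      lam k • kerCoord hp lam (phiIdx p (mem_Icc.2 ⟨by omega, by omega⟩))

theorem cohCoord_kerVec (s t : Fin 3 ⊕ ↥(Icc 1 p)) :
    cohCoord hp lam s (kerVec hp hp3 lam (cohIdx hp t)) = if s = t then 1 else 0 := by
  have h : kerCoord hp lam (cohIdx hp s) (kerVec hp hp3 lam (cohIdx hp t)) =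
      if s = t then 1 else 0 := by
    rw [kerCoord_kerVec]
    exact if_congr (cohIdx_injective hp).eq_iff rfl rfl
  rcases s with s | s
  · exact h
  · change kerCoord hp lam _ _ - lam s • kerCoord hp lam _ _ = _
    rw [h, kerCoord_kerVec, if_neg (phiIdx_ne_cohIdx hp t), smul_zero, sub_zero]

/-- On the coboundary of `ψ` the `ē^k`-coordinate is `λ_k ψ(e_p)` and the `φ_p`-coefficient is
`ψ(e_p)`, so the correction cancels exactly. The other three vanish because `a_{1,4} = a_{2,5} = 0`
and `e_{p+1} = 0`. -/
theorem cohCoord_d1Star (s : Fin 3 ⊕ ↥(Icc 1 p)) (ψ : Module.Dual F (G F p)) :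
    cohCoord hp lam s ⟨_, d1Star_mem_ker hp lam ψ⟩ = 0 := by
  rcases s with s | s
  · fin_cases s
    · refine (formEval_d1Star hp lam ψ (by omega) (by omega)).trans ?_
      rw [a_eq_zero (by omega), Int.cast_zero, zero_mul]
    · refine (formEval_d1Star hp lam ψ (by omega) (by omega)).trans ?_
      rw [a_eq_zero (by omega), Int.cast_zero, zero_mul]
    · refine (phiCoeff_d1Star hp lam ψ (k := p + 1) (by omega)).trans ?_
      rw [e_eq_zero (by simp), map_zero]
  · change opEval s.1 (d1Star hp lam ψ) - lam s • phiCoeff p (d1Star hp lam ψ) = 0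
    rw [opEval_d1Star, phiCoeff_d1Star hp lam ψ (by omega), smul_eq_mul, sub_self]

/-- The coordinate functionals of the basis of `H²_*`. -/
def h2Coord (s : Fin 3 ⊕ ↥(Icc 1 p)) : Module.Dual F (H2Star hp lam) :=
  Submodule.liftQ _ (cohCoord hp lam s) (by
    rintro ⟨_, hc⟩ ⟨ψ, rfl⟩
    exact cohCoord_d1Star hp lam s ψ)

/-- The classes of the explicit cocycles that span `H²_*`. -/
def h2Vec (s : Fin 3 ⊕ ↥(Icc 1 p)) : H2Star hp lam :=
  Submodule.Quotient.mk (kerVec hp hp3 lam (cohIdx hp s))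

include hp3 in
-- The functionals vanish on no more than the coboundaries: the `φ_k`-coefficients of the cocycle
-- dictate `ψ`, and the difference from its coboundary has all kernel coordinates zero.
theorem mem_range_d1Star_of_cohCoord {c : LinearMap.ker (d2Star hp lam)}
    (h : ∀ s, cohCoord hp lam s c = 0) : c.1 ∈ LinearMap.range (d1Star hp lam) := by
  -- The values of `ψ` on `e_1` and `e_2` are immaterial, since brackets start at `e_3` and `p > 2`.
  let ψ : Module.Dual F (G F p) := (eBasis F p).constr F fun k => phiCoeff k.1 c.1
  have hψ : ∀ k ∈ Icc 1 p, ψ (e k) = phiCoeff k c.1 := by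
    intro k hk
    have := (eBasis F p).constr_basis F (fun k => phiCoeff k.1 c.1) ⟨k, hk⟩
    rwa [eBasis_apply] at this
  have h3 : (3 : ℕ) ≤ p := by omega
  have hd := cohCoord_d1Star hp lam (ψ := ψ)
  have hphi : ∀ k ∈ Icc 3 (p + 1), phiCoeff k (d1Star hp lam ψ) = phiCoeff k c.1 := by
    intro k hk
    obtain hk' | rfl : k ≤ p ∨ k = p + 1 := by
      have := (mem_Icc.1 hk).2
      omega
    · have h1 := (mem_Icc.1 hk).1
      rw [phiCoeff_d1Star hp lam ψ h1, hψ k (mem_Icc.2 ⟨by omega, hk'⟩)]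
    · exact (hd (Sum.inl 2)).trans (h (Sum.inl 2)).symm
  have hop : ∀ k ∈ Icc 1 p, opEval k (d1Star hp lam ψ) = opEval k c.1 := by
    intro k hk
    have e1 : opEval k (d1Star hp lam ψ) - lam ⟨k, hk⟩ • phiCoeff p (d1Star hp lam ψ) = 0 :=
      hd (Sum.inr ⟨k, hk⟩)
    have e2 : opEval k c.1 - lam ⟨k, hk⟩ • phiCoeff p c.1 = 0 := h (Sum.inr ⟨k, hk⟩)
    -- Both corrected coordinates vanish and the `φ_p`-coefficients agree, so the uncorrected ones
    -- agree as well.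
    rw [hphi p (mem_Icc.2 ⟨h3, by omega⟩)] at e1
    exact (sub_eq_zero.1 e1).trans (sub_eq_zero.1 e2).symm
  have key := eq_zero_of_mem_ker hp hp3 (lam := lam) (c := d1Star hp lam ψ - c.1)
    (sub_mem (d1Star_mem_ker hp lam ψ) c.2)
    ((map_sub (formEval 1 4) _ _).trans
      (sub_eq_zero.2 ((hd (Sum.inl 0)).trans (h (Sum.inl 0)).symm)))
    ((map_sub (formEval 2 5) _ _).trans
      (sub_eq_zero.2 ((hd (Sum.inl 1)).trans (h (Sum.inl 1)).symm)))
    (fun k hk => by rw [map_sub, hphi k hk, sub_self])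
    (fun k hk => by rw [map_sub, hop k hk, sub_self])
  exact ⟨ψ, sub_eq_zero.1 key⟩

theorem dualBases_h2Vec : Module.DualBases (h2Vec hp hp3 lam) (h2Coord hp lam) := by
  refine dualBases_of_apply (cohCoord_kerVec hp hp3 lam) fun m hm => ?_
  obtain ⟨c, rfl⟩ := Submodule.Quotient.mk_surjective _ m
  exact (Submodule.Quotient.mk_eq_zero _).2 (mem_range_d1Star_of_cohCoord hp hp3 lam hm)

end Cohomology

end

end AffineNil

theorem mainTheorem3 (p : ℕ) [Fact p.Prime] (hp : 5 ≤ p) (hp3 : p % 3 ≠ 2)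
    (F : Type*) [Field F] [CharP F p] (lam : ↥(Finset.Icc 1 p) → F) :
    ∃ b : Module.Basis (Fin 2 ⊕ ↥(Finset.Icc 3 (p + 1)) ⊕ ↥(Finset.Icc 1 p)) F
        (LinearMap.ker (AffineNil.d2Star hp lam)),
      (b (Sum.inl 0)).1 = AffineNil.tildePair hp (AffineNil.eDual 1 4) ∧
      (b (Sum.inl 1)).1 = AffineNil.tildePair hp (AffineNil.eDual 2 5) ∧
      (∀ k : ↥(Finset.Icc 3 (p + 1)),
        (b (Sum.inr (Sum.inl k))).1 = AffineNil.tildePair hp (AffineNil.phi k)) ∧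
      (∀ k : ↥(Finset.Icc 1 p), (b (Sum.inr (Sum.inr k))).1 = AffineNil.eBarPair hp k) ∧
      Module.finrank F (AffineNil.H2Star hp lam) = p + 3 ∧
      ∃ c : Module.Basis (Fin 3 ⊕ ↥(Finset.Icc 1 p)) F (AffineNil.H2Star hp lam),
        c (Sum.inl 0) = Submodule.Quotient.mk (b (Sum.inl 0)) ∧
        c (Sum.inl 1) = Submodule.Quotient.mk (b (Sum.inl 1)) ∧
        c (Sum.inl 2) = Submodule.Quotient.mk
          (b (Sum.inr (Sum.inl ⟨p + 1, Finset.mem_Icc.2 ⟨by omega, le_rfl⟩⟩))) ∧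
        ∀ k : ↥(Finset.Icc 1 p),
          c (Sum.inr k) = Submodule.Quotient.mk (b (Sum.inr (Sum.inr k))) := by
  have hb := AffineNil.dualBases_kerVec hp hp3 lam
  have hc := AffineNil.dualBases_h2Vec hp hp3 lam
  refine ⟨hb.basis, ?_⟩
  rw [hb.coe_basis]
  refine ⟨rfl, rfl, fun _ => rfl, fun _ => rfl, ?_, hc.basis, ?_⟩
  · rw [Module.finrank_eq_card_basis hc.basis]
    simp [add_comm]
  · rw [hc.coe_basis]
    exact ⟨rfl, rfl, rfl, fun _ => rfl⟩
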